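/- Let $(R,P)$ be a commutative Noetherian local ring, let $I, J \subsetneq R$ be proper ideals, let $M, N$ be finitely generated $R$-modules, and let $i \ge 0$ be an integer. Let $\lambda$ denote length over $R$, and let all tensor products and $\operatorname{Tor}$'s be taken over $R$, with $\operatorname{Tor}_j = 0$ for $j<0$. Suppose that $M \otimes_R N$ has finite length. Then there are a polynomial $p \in \mathbb{Q}[X,Y]$ and an integer $k \ge 0$ such that, for all integers $m, n \ge k$, the module $\operatorname{Tor}_i(M/I^nM, N/J^mN)$ has finite length and $$\lambda(\operatorname{Tor}_i(M/I^nM, N/J^mN)) = p(m,n).$$ Moreover, for all sufficiently large $m$ and $n$, $$\lambda(\operatorname{Tor}_i(M/I^nM, N/J^mN)) = \lambda(\operatorname{Tor}_i(M,N)) + \lambda(\operatorname{Tor}_{i-1}(I^nM,N)) + \lambda(\operatorname{Tor}_{i-1}(M,J^mN)) + \lambda(\operatorname{Tor}_{i-2}(I^nM,J^mN)).$$ -/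

import Mathlib

open CategoryTheory
open scoped TensorProduct

universe u

/-- The length `λ(Tor_i^R(M, N))` of the `i`-th Tor module as an `R`-module, for an integer `i`;
in negative degrees `Tor` is the zero module. -/
noncomputable def torLength (R : Type u) [CommRing R] (i : ℤ)
    (M : Type u) [AddCommGroup M] [Module R M] (N : Type u) [AddCommGroup N] [Module R N] : ℕ∞ :=
  match i with
  | Int.ofNat k =>
      Module.length R (((Tor (ModuleCat.{u} R) k).obj (ModuleCat.of R M)).obj (ModuleCat.of R N))
  | Int.negSucc _ => 0

/-- For all sufficiently large `m` and `n`, the value `f m n` is finite and equals `p(m, n)`, for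
one polynomial `p` in two variables with rational coefficients. -/
def EventuallyPolynomial (f : ℕ → ℕ → ℕ∞) : Prop :=
  ∃ p : MvPolynomial (Fin 2) ℚ, ∃ k : ℕ, ∀ m n : ℕ, k ≤ m → k ≤ n →
    ∃ l : ℕ, f m n = (l : ℕ∞) ∧ (l : ℚ) = MvPolynomial.eval ![(m : ℚ), (n : ℚ)] p

/-! ### Naturality in the functor of the comparison between its zeroth left derived functor and
itself. -/

section LeftDerivedZero

variable {C D : Type*} [Category* C] [Category* D] [Abelian C] [HasProjectiveResolutions C]
  [Abelian D]

/-! Every prime containing `ann M + ann N` lies in the support of `M ⊗ N`, so finite length gives an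
`e` with `P^e ≤ ann M + ann N`. Annihilators of either argument kill Tor, hence `P^e` kills
`Tor_j(X, Y)` for all submodules `X` of `M` and `Y` of `N`, with `e` independent of `X`, `Y` and
`j`. These Tor modules are finitely generated, so they have finite length.

The modules `Tor_j(I^nM, J^mN)` are the bigraded pieces of Tor of the Rees modules of `M` and `N`,
which is Noetherian over a tensor product of two polynomial rings whose variables act as generators
of `I` and `J`. This is recorded as a chain condition on families of submodules stable under those
multiplications (`familyNoetherian_tor`), so that no module structure over the large ring is needed
on Tor. It has two consequences.

Lengths of the pieces are eventually polynomial, by a Hilbert-Serre induction on the number of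
operators (`FamilyNoetherian.eventuallyPoly`). Also, the family is generated in bounded `n`-degree,
uniformly in `m`, so for large `n` the image of `Tor_j(I^(n+e)M, J^mN)` in `Tor_j(I^nM, J^mN)` lies
in `I^e Tor_j(I^nM, J^mN) = 0`; likewise in the other variable (`exists_torMap_incl_eq_zero`).

Thus maps induced by the inclusions of `I^nM` and `J^mN` vanish, long exact sequences split into
short ones, and lengths add: one use in the second variable and two in the first give the formula.
Each of its four terms is a Hilbert function of the above kind, for `I` or the unit ideal and `J` or
the unit ideal. -/

theorem leftDerived_zero_app_comp_fromLeftDerivedZero {F G : C ⥤ D} [F.Additive] [G.Additive]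
    (α : F ⟶ G) {Y Y' : C} (g : Y ⟶ Y') :
    ((NatTrans.leftDerived α 0).app Y ≫ (G.leftDerived 0).map g) ≫ G.fromLeftDerivedZero.app Y' =
      F.fromLeftDerivedZero.app Y ≫ α.app Y ≫ G.map g := by
  rw [Category.assoc, NatTrans.naturality]
  have h : (NatTrans.leftDerived α 0).app Y ≫ G.fromLeftDerivedZero.app Y =
      F.fromLeftDerivedZero.app Y ≫ α.app Y := by
    let P := projectiveResolution Y
    have h1 : HomologicalComplex.opcyclesMap
        ((NatTrans.mapHomologicalComplex α (ComplexShape.down ℕ)).app P.complex) 0 ≫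
        P.fromLeftDerivedZero' G = P.fromLeftDerivedZero' F ≫ α.app Y := by
      rw [← cancel_epi (HomologicalComplex.pOpcycles _ _)]
      rw [HomologicalComplex.p_opcyclesMap_assoc,
        ProjectiveResolution.pOpcycles_comp_fromLeftDerivedZero',
        ProjectiveResolution.pOpcycles_comp_fromLeftDerivedZero'_assoc]
      exact (α.naturality _).symm
    have h2 : HomologicalComplex.homologyMap
        ((NatTrans.mapHomologicalComplex α (ComplexShape.down ℕ)).app P.complex) 0 ≫
        (ChainComplex.isoHomologyι₀ _).hom ≫ P.fromLeftDerivedZero' G =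
        (ChainComplex.isoHomologyι₀ _).hom ≫ P.fromLeftDerivedZero' F ≫ α.app Y := by
      rw [← h1]
      exact HomologicalComplex.homologyι_naturality_assoc _ _ _
    rw [P.leftDerived_app_eq α 0, P.fromLeftDerivedZero_eq G, P.fromLeftDerivedZero_eq F]
    simp only [Category.assoc, Iso.inv_hom_id_assoc]
    refine (congrArg _ h2).trans ?_
    exact (congrArg _ (Category.assoc _ _ _)).symm
  rw [← Category.assoc, ← Category.assoc, h]

end LeftDerivedZero

/-! ### Tor as a bifunctor on modules, and its long exact sequence in the first variable. -/

section TorModule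

variable {R : Type u} [CommRing R]

/-- The module `Tor_i(X, Y)`. -/
def TorMod (R : Type u) [CommRing R] (i : ℕ) (X Y : Type u) [AddCommGroup X]
    [Module R X] [AddCommGroup Y] [Module R Y] : Type u :=
  ((Tor (ModuleCat.{u} R) i).obj (ModuleCat.of R X)).obj (ModuleCat.of R Y)

noncomputable instance (R : Type u) [CommRing R] (i : ℕ) (X Y : Type u) [AddCommGroup X]
    [Module R X] [AddCommGroup Y] [Module R Y] : AddCommGroup (TorMod R i X Y) :=
  inferInstanceAs (AddCommGroup
    (((Tor (ModuleCat.{u} R) i).obj (ModuleCat.of R X)).obj (ModuleCat.of R Y)))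

noncomputable instance (R : Type u) [CommRing R] (i : ℕ) (X Y : Type u) [AddCommGroup X]
    [Module R X] [AddCommGroup Y] [Module R Y] : Module R (TorMod R i X Y) :=
  inferInstanceAs (Module R
    (((Tor (ModuleCat.{u} R) i).obj (ModuleCat.of R X)).obj (ModuleCat.of R Y)))

theorem torLength_natCast {R : Type u} [CommRing R] (i : ℕ) (X Y : Type u) [AddCommGroup X]
    [Module R X] [AddCommGroup Y] [Module R Y] :
    torLength R i X Y = Module.length R (TorMod R i X Y) :=
  rfl

variable {X X' X'' Y Y' Y'' : Type u} [AddCommGroup X] [Module R X] [AddCommGroup X'] [Module R X']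
  [AddCommGroup X''] [Module R X''] [AddCommGroup Y] [Module R Y] [AddCommGroup Y'] [Module R Y']
  [AddCommGroup Y''] [Module R Y'']

/-- The map induced on `Tor_i` by a pair of linear maps. -/
noncomputable def torMap (i : ℕ) (f : X →ₗ[R] X') (g : Y →ₗ[R] Y') :
    TorMod R i X Y →ₗ[R] TorMod R i X' Y' :=
  (((Tor (ModuleCat.{u} R) i).map (ModuleCat.ofHom f)).app _ ≫
    ((Tor (ModuleCat.{u} R) i).obj _).map (ModuleCat.ofHom g)).hom

theorem torMap_id (i : ℕ) :
    torMap i (LinearMap.id : X →ₗ[R] X) (LinearMap.id : Y →ₗ[R] Y) = LinearMap.id := by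
  unfold torMap
  rw [ModuleCat.ofHom_id, ModuleCat.ofHom_id, CategoryTheory.Functor.map_id,
    CategoryTheory.Functor.map_id]
  rfl

theorem torMap_comp (i : ℕ) (f : X →ₗ[R] X') (f' : X' →ₗ[R] X'') (g : Y →ₗ[R] Y')
    (g' : Y' →ₗ[R] Y'') :
    torMap i (f' ∘ₗ f) (g' ∘ₗ g) = torMap i f' g' ∘ₗ torMap i f g := by
  have h : ((Tor (ModuleCat.{u} R) i).map (ModuleCat.ofHom (f' ∘ₗ f))).app (ModuleCat.of R Y) ≫
      ((Tor (ModuleCat.{u} R) i).obj _).map (ModuleCat.ofHom (g' ∘ₗ g)) =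
    (((Tor (ModuleCat.{u} R) i).map (ModuleCat.ofHom f)).app _ ≫
      ((Tor (ModuleCat.{u} R) i).obj _).map (ModuleCat.ofHom g)) ≫
    (((Tor (ModuleCat.{u} R) i).map (ModuleCat.ofHom f')).app _ ≫
      ((Tor (ModuleCat.{u} R) i).obj _).map (ModuleCat.ofHom g')) := by
    rw [ModuleCat.ofHom_comp, ModuleCat.ofHom_comp, Functor.map_comp, Functor.map_comp,
      NatTrans.comp_app]
    simp only [Category.assoc, NatTrans.naturality_assoc]
  exact congr($(h).hom)

theorem torMap_torMap (i : ℕ) (f : X →ₗ[R] X') (f' : X' →ₗ[R] X'') (g : Y →ₗ[R] Y')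
    (g' : Y' →ₗ[R] Y'') (t : TorMod R i X Y) :
    torMap i f' g' (torMap i f g t) = torMap i (f' ∘ₗ f) (g' ∘ₗ g) t := by
  rw [torMap_comp]; rfl

/-- Linear equivalences induce an equivalence on `Tor_i`. -/
noncomputable def torEquiv (i : ℕ) (e : X ≃ₗ[R] X') (e' : Y ≃ₗ[R] Y') :
    TorMod R i X Y ≃ₗ[R] TorMod R i X' Y' :=
  LinearEquiv.ofLinearMap (torMap i e.toLinearMap e'.toLinearMap)
    (torMap i e.symm.toLinearMap e'.symm.toLinearMap)
    (by rw [← torMap_comp]; simp [torMap_id]) (by rw [← torMap_comp]; simp [torMap_id])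

instance tensoringLeft_preservesFiniteColimits (X : ModuleCat.{u} R) :
    Limits.PreservesFiniteColimits ((MonoidalCategory.tensoringLeft (ModuleCat.{u} R)).obj X) :=
  inferInstanceAs (Limits.PreservesFiniteColimits (MonoidalCategory.tensorLeft X))

/-- `Tor_0` is the tensor product. -/
noncomputable def torZeroEquiv (X Y : Type u) [AddCommGroup X]
    [Module R X] [AddCommGroup Y] [Module R Y] : TorMod R 0 X Y ≃ₗ[R] X ⊗[R] Y :=
  (((((MonoidalCategory.tensoringLeft (ModuleCat.{u} R)).obj
    (ModuleCat.of R X)).leftDerivedZeroIsoSelf).app (ModuleCat.of R Y))).toLinearEquiv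

theorem torZeroEquiv_torMap (f : X →ₗ[R] X') (g : Y →ₗ[R] Y') (t : TorMod R 0 X Y) :
    torZeroEquiv X' Y' (torMap 0 f g t) = TensorProduct.map f g (torZeroEquiv X Y t) := by
  have h := leftDerived_zero_app_comp_fromLeftDerivedZero
    ((MonoidalCategory.tensoringLeft (ModuleCat.{u} R)).map (ModuleCat.ofHom f)) (ModuleCat.ofHom g)
  refine (congr($(h).hom t)).trans ?_
  have h2 : TensorProduct.map f g = LinearMap.lTensor X' g ∘ₗ LinearMap.rTensor Y f := by simp
  rw [h2]
  rfl

/-- The complex `X ⊗ P` for a complex `P`. -/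
noncomputable abbrev tensorComplex (X : ModuleCat.{u} R) (P : ChainComplex (ModuleCat.{u} R) ℕ) :
    ChainComplex (ModuleCat.{u} R) ℕ :=
  (((MonoidalCategory.tensoringLeft (ModuleCat.{u} R)).obj X).mapHomologicalComplex _).obj P

theorem subsingleton_torMod_succ_of_flat [Module.Flat R X] (i : ℕ) :
    Subsingleton (TorMod R (i + 1) X Y) := by
  let P := projectiveResolution (ModuleCat.of R Y)
  have h1 : (tensorComplex (ModuleCat.of R X) P.complex).ExactAt (i + 1) := by
    have h2 := Module.Flat.lTensor_shortComplex_exact (ModuleCat.of R X) _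
      (P.complex_exactAt_succ i)
    have h3 : ((P.complex.sc (i + 1)).map
      ((MonoidalCategory.tensoringLeft (ModuleCat.{u} R)).obj (ModuleCat.of R X))).Exact := h2
    exact h3
  rw [HomologicalComplex.exactAt_iff_isZero_homology] at h1
  exact ModuleCat.subsingleton_of_isZero
    (h1.of_iso (P.isoLeftDerivedObj ((MonoidalCategory.tensoringLeft _).obj _) (i + 1)))

/-- The map of complexes `X ⊗ P ⟶ X' ⊗ P'`. -/
noncomputable abbrev tensorComplexMap {X X' : ModuleCat.{u} R}
    {P P' : ChainComplex (ModuleCat.{u} R) ℕ} (f : X ⟶ X') (φ : P ⟶ P') :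
    tensorComplex X P ⟶ tensorComplex X' P' :=
  (NatTrans.mapHomologicalComplex ((MonoidalCategory.tensoringLeft (ModuleCat.{u} R)).map f) _).app P
  ≫ (((MonoidalCategory.tensoringLeft (ModuleCat.{u} R)).obj X').mapHomologicalComplex _).map φ

/-- The complex `X ⊗ P` computes `Tor`. -/
noncomputable abbrev torIso (i : ℕ) (X : ModuleCat.{u} R) {Y : ModuleCat.{u} R}
    (P : ProjectiveResolution Y) :
    ((Tor (ModuleCat.{u} R) i).obj X).obj Y ≅ (tensorComplex X P.complex).homology i :=
  P.isoLeftDerivedObj ((MonoidalCategory.tensoringLeft (ModuleCat.{u} R)).obj X) i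

/-- Any chain map `φ` lifting `g` may be used. This turns statements about Tor into statements about
homology of tensored resolutions. -/
theorem torIso_naturality (i : ℕ) {X X' Y Y' : ModuleCat.{u} R} (f : X ⟶ X') (g : Y ⟶ Y')
    (P : ProjectiveResolution Y) (P' : ProjectiveResolution Y') (φ : P.complex ⟶ P'.complex)
    (comm : φ.f 0 ≫ P'.π.f 0 = P.π.f 0 ≫ g) :
    (((Tor (ModuleCat.{u} R) i).map f).app Y ≫
      ((Tor (ModuleCat.{u} R) i).obj X').map g) ≫ (torIso i X' P').hom =
    (torIso i X P).hom ≫ HomologicalComplex.homologyMap (tensorComplexMap f φ) i := by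
  rw [Category.assoc]
  have h1 := ProjectiveResolution.isoLeftDerivedObj_hom_naturality g P P' φ comm
    ((MonoidalCategory.tensoringLeft (ModuleCat.{u} R)).obj X') i
  have h2 := ProjectiveResolution.leftDerived_app_eq
    ((MonoidalCategory.tensoringLeft (ModuleCat.{u} R)).map f) P i
  have h1' : ((Tor (ModuleCat.{u} R) i).obj X').map g ≫ (torIso i X' P').hom =
    (torIso i X' P).hom ≫ HomologicalComplex.homologyMap
    ((((MonoidalCategory.tensoringLeft (ModuleCat.{u} R)).obj X').mapHomologicalComplex _).map φ) i
    := h1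
  have h2' : ((Tor (ModuleCat.{u} R) i).map f).app Y = (torIso i X P).hom ≫
    HomologicalComplex.homologyMap ((NatTrans.mapHomologicalComplex
      ((MonoidalCategory.tensoringLeft (ModuleCat.{u} R)).map f) _).app P.complex) i ≫
      (torIso i X' P).inv := h2
  rw [h1', h2', HomologicalComplex.homologyMap_comp]
  simp only [Category.assoc, Iso.inv_hom_id_assoc]

theorem tensorComplexMap_comp {X X' X'' : ModuleCat.{u} R}
    {P P' P'' : ChainComplex (ModuleCat.{u} R) ℕ} (f : X ⟶ X') (f' : X' ⟶ X'') (φ : P ⟶ P')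
    (φ' : P' ⟶ P'') :
    tensorComplexMap (f ≫ f') (φ ≫ φ') = tensorComplexMap f φ ≫ tensorComplexMap f' φ' := by
  rw [tensorComplexMap, tensorComplexMap, tensorComplexMap, Functor.map_comp, Functor.map_comp,
    NatTrans.mapHomologicalComplex_comp, NatTrans.comp_app]
  simp only [Category.assoc]
  rw [NatTrans.naturality_assoc]

theorem tensorComplexMap_zero_left {X X' : ModuleCat.{u} R}
    {P P' : ChainComplex (ModuleCat.{u} R) ℕ} (φ : P ⟶ P') :
    tensorComplexMap (0 : X ⟶ X') φ = 0 := by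
  ext n : 1
  have : (tensorComplexMap (0 : X ⟶ X') φ).f n =
    MonoidalCategoryStruct.whiskerRight (0 : X ⟶ X') (P.X n) ≫
      MonoidalCategoryStruct.whiskerLeft X' (φ.f n) := rfl
  rw [this, MonoidalPreadditive.zero_whiskerRight, Limits.zero_comp]
  rfl

/-- A short complex of modules tensored with a complex. -/
noncomputable abbrev tensorShortComplex (S : ShortComplex (ModuleCat.{u} R))
    (P : ChainComplex (ModuleCat.{u} R) ℕ) : ShortComplex (ChainComplex (ModuleCat.{u} R) ℕ) where
  X₁ := tensorComplex S.X₁ P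
  X₂ := tensorComplex S.X₂ P
  X₃ := tensorComplex S.X₃ P
  f := tensorComplexMap S.f (𝟙 P)
  g := tensorComplexMap S.g (𝟙 P)
  zero := by
    rw [← tensorComplexMap_comp, S.zero, tensorComplexMap_zero_left]

/-- The terms of the resolution are projective, hence flat, so exactness holds degree by degree. The
homology sequence then gives the long exact sequence in the variable that is not resolved. -/
theorem tensorShortComplex_shortExact {S : ShortComplex (ModuleCat.{u} R)} (hS : S.ShortExact)
    {Y : ModuleCat.{u} R} (P : ProjectiveResolution Y) :
    (tensorShortComplex S P.complex).ShortExact := by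
  apply HomologicalComplex.shortExact_of_degreewise_shortExact
  intro n
  have : Module.Projective R (P.complex.X n) :=
    (IsProjective.iff_projective _).2 (P.projective n)
  have h : (S.map (MonoidalCategory.tensorRight (P.complex.X n))).ShortExact :=
    hS.map_of_exact _
  refine ShortComplex.shortExact_of_iso (ShortComplex.isoMk
    (S₁ := S.map (MonoidalCategory.tensorRight (P.complex.X n)))
    (S₂ := (tensorShortComplex S P.complex).map (HomologicalComplex.eval _ _ n))
    (Iso.refl _) (Iso.refl _) (Iso.refl _) ?_ ?_) h
  · have : ((tensorShortComplex S P.complex).map (HomologicalComplex.eval _ _ n)).f =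
      MonoidalCategoryStruct.whiskerRight S.f (P.complex.X n) ≫
      MonoidalCategoryStruct.whiskerLeft S.X₂ (𝟙 (P.complex.X n)) := rfl
    rw [this, MonoidalCategory.whiskerLeft_id]
    simp only [Iso.refl_hom]
    erw [Category.id_comp, Category.comp_id]
  · have : ((tensorShortComplex S P.complex).map (HomologicalComplex.eval _ _ n)).g =
      MonoidalCategoryStruct.whiskerRight S.g (P.complex.X n) ≫
      MonoidalCategoryStruct.whiskerLeft S.X₃ (𝟙 (P.complex.X n)) := rfl
    rw [this, MonoidalCategory.whiskerLeft_id]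
    simp only [Iso.refl_hom]
    erw [Category.id_comp, Category.comp_id]

/-- A pair of morphisms induces a map of tensored short complexes. -/
noncomputable abbrev tensorShortComplexMap {S S' : ShortComplex (ModuleCat.{u} R)} (ψ : S ⟶ S')
    {P P' : ChainComplex (ModuleCat.{u} R) ℕ} (φ : P ⟶ P') :
    tensorShortComplex S P ⟶ tensorShortComplex S' P' where
  τ₁ := tensorComplexMap ψ.τ₁ φ
  τ₂ := tensorComplexMap ψ.τ₂ φ
  τ₃ := tensorComplexMap ψ.τ₃ φ
  comm₁₂ := by
    rw [← tensorComplexMap_comp, ← tensorComplexMap_comp, ψ.comm₁₂, Category.comp_id,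
      Category.id_comp]
  comm₂₃ := by
    rw [← tensorComplexMap_comp, ← tensorComplexMap_comp, ψ.comm₂₃, Category.comp_id,
      Category.id_comp]


/-- The connecting morphism. -/
noncomputable def torConn {S : ShortComplex (ModuleCat.{u} R)} (hS : S.ShortExact)
    (i : ℕ) (Y : ModuleCat.{u} R) :
    ((Tor (ModuleCat.{u} R) (i + 1)).obj S.X₃).obj Y ⟶ ((Tor (ModuleCat.{u} R) i).obj S.X₁).obj Y :=
  (torIso (i + 1) S.X₃ (projectiveResolution Y)).hom ≫
    (tensorShortComplex_shortExact hS (projectiveResolution Y)).δ (i + 1) i rfl ≫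
    (torIso i S.X₁ (projectiveResolution Y)).inv

/-- Lift `g` to the resolutions; with `ψ` it gives a morphism of short exact sequences of complexes,
and the homology connecting map is natural. -/
theorem torConn_naturality {S S' : ShortComplex (ModuleCat.{u} R)} (hS : S.ShortExact)
    (hS' : S'.ShortExact) (ψ : S ⟶ S') (i : ℕ) {Y Y' : ModuleCat.{u} R} (g : Y ⟶ Y') :
    torConn hS i Y ≫ ((Tor (ModuleCat.{u} R) i).map ψ.τ₁).app Y ≫
      ((Tor (ModuleCat.{u} R) i).obj S'.X₁).map g =
    (((Tor (ModuleCat.{u} R) (i + 1)).map ψ.τ₃).app Y ≫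
      ((Tor (ModuleCat.{u} R) (i + 1)).obj S'.X₃).map g) ≫ torConn hS' i Y' := by
  have comm : (ProjectiveResolution.lift g (projectiveResolution Y) (projectiveResolution Y')).f 0
      ≫ (projectiveResolution Y').π.f 0 = (projectiveResolution Y).π.f 0 ≫ g :=
    ProjectiveResolution.lift_commutes_zero _ _ _
  have h1 := torIso_naturality i ψ.τ₁ g _ _ _ comm
  have h3 := torIso_naturality (i + 1) ψ.τ₃ g _ _ _ comm
  have h := HomologicalComplex.HomologySequence.δ_naturality (tensorShortComplexMap ψ
    (ProjectiveResolution.lift g (projectiveResolution Y) (projectiveResolution Y')))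
    (tensorShortComplex_shortExact hS _) (tensorShortComplex_shortExact hS' _) (i + 1) i rfl
  rw [← cancel_mono (torIso i S'.X₁ (projectiveResolution Y')).hom]
  simp only [torConn, Category.assoc, Iso.inv_hom_id, Category.comp_id] at h1 h3 ⊢
  rw [h1, reassoc_of% h3, Iso.inv_hom_id_assoc]
  congr 1

theorem torMap_id_right_eq (i : ℕ) (f : X →ₗ[R] X') :
    torMap i f (LinearMap.id : Y →ₗ[R] Y) =
      (((Tor (ModuleCat.{u} R) i).map (ModuleCat.ofHom f)).app (ModuleCat.of R Y)).hom := by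
  unfold torMap
  rw [ModuleCat.ofHom_id, CategoryTheory.Functor.map_id, Category.comp_id]

theorem torIso_naturality_left (i : ℕ) {X X' Y : ModuleCat.{u} R} (f : X ⟶ X')
    (P : ProjectiveResolution Y) :
    ((Tor (ModuleCat.{u} R) i).map f).app Y ≫ (torIso i X' P).hom =
    (torIso i X P).hom ≫ HomologicalComplex.homologyMap (tensorComplexMap f (𝟙 P.complex)) i := by
  have := torIso_naturality i f (𝟙 Y) P P (𝟙 _)
    ((Category.id_comp _).trans (Category.comp_id _).symm)
  rwa [CategoryTheory.Functor.map_id, Category.comp_id] at this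

theorem tor_exact_middle {S : ShortComplex (ModuleCat.{u} R)} (hS : S.ShortExact) (i : ℕ)
    (Y : ModuleCat.{u} R) :
    Function.Exact (((Tor (ModuleCat.{u} R) i).map S.f).app Y).hom
      (((Tor (ModuleCat.{u} R) i).map S.g).app Y).hom := by
  have h := (tensorShortComplex_shortExact hS (projectiveResolution Y)).homology_exact₂ i
  have e := ShortComplex.exact_of_iso (ShortComplex.isoMk
    (S₂ := ShortComplex.mk (((Tor (ModuleCat.{u} R) i).map S.f).app Y)
      (((Tor (ModuleCat.{u} R) i).map S.g).app Y) (by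
        rw [← cancel_mono (torIso i S.X₃ (projectiveResolution Y)).hom, Category.assoc,
          torIso_naturality_left, ← Category.assoc, torIso_naturality_left, Category.assoc,
          ← HomologicalComplex.homologyMap_comp, ← tensorComplexMap_comp, S.zero,
          tensorComplexMap_zero_left, HomologicalComplex.homologyMap_zero, Limits.comp_zero,
          Limits.zero_comp]))
    (torIso i S.X₁ (projectiveResolution Y)).symm (torIso i S.X₂ (projectiveResolution Y)).symm
    (torIso i S.X₃ (projectiveResolution Y)).symm
    (by
      dsimp only [Iso.symm_hom]
      rw [Iso.inv_comp_eq, ← Category.assoc, Iso.eq_comp_inv, torIso_naturality_left])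
    (by
      dsimp only [Iso.symm_hom]
      rw [Iso.inv_comp_eq, ← Category.assoc, Iso.eq_comp_inv, torIso_naturality_left])) h
  exact (ShortComplex.ShortExact.moduleCat_exact_iff_function_exact _).1 e

theorem tor_exact_left {S : ShortComplex (ModuleCat.{u} R)} (hS : S.ShortExact) (i : ℕ)
    (Y : ModuleCat.{u} R) :
    Function.Exact (torConn hS i Y).hom (((Tor (ModuleCat.{u} R) i).map S.f).app Y).hom := by
  have h := (tensorShortComplex_shortExact hS (projectiveResolution Y)).homology_exact₁ (i + 1) i
    rfl
  have e := ShortComplex.exact_of_iso (ShortComplex.isoMk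
    (S₂ := ShortComplex.mk (torConn hS i Y) (((Tor (ModuleCat.{u} R) i).map S.f).app Y)
      (by
        rw [← cancel_mono (torIso i S.X₂ (projectiveResolution Y)).hom, Category.assoc,
          torIso_naturality_left, torConn]
        simp only [Category.assoc, Iso.inv_hom_id_assoc]
        rw [(tensorShortComplex_shortExact hS (projectiveResolution Y)).δ_comp (i + 1) i rfl,
          Limits.comp_zero, Limits.zero_comp]))
    (torIso (i + 1) S.X₃ (projectiveResolution Y)).symm
    (torIso i S.X₁ (projectiveResolution Y)).symm
    (torIso i S.X₂ (projectiveResolution Y)).symm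
    (by
      dsimp only [Iso.symm_hom]
      rw [Iso.inv_comp_eq, torConn])
    (by
      dsimp only [Iso.symm_hom]
      rw [Iso.inv_comp_eq, ← Category.assoc, Iso.eq_comp_inv, torIso_naturality_left])) h
  exact (ShortComplex.ShortExact.moduleCat_exact_iff_function_exact _).1 e

theorem tor_exact_right {S : ShortComplex (ModuleCat.{u} R)} (hS : S.ShortExact) (i : ℕ)
    (Y : ModuleCat.{u} R) :
    Function.Exact (((Tor (ModuleCat.{u} R) (i + 1)).map S.g).app Y).hom (torConn hS i Y).hom := by
  have h := (tensorShortComplex_shortExact hS (projectiveResolution Y)).homology_exact₃ (i + 1) i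
    rfl
  have e := ShortComplex.exact_of_iso (ShortComplex.isoMk
    (S₂ := ShortComplex.mk (((Tor (ModuleCat.{u} R) (i + 1)).map S.g).app Y) (torConn hS i Y)
      (by
        rw [torConn, ← Category.assoc, torIso_naturality_left, Category.assoc]
        rw [(tensorShortComplex_shortExact hS (projectiveResolution Y)).comp_δ_assoc (i + 1) i rfl,
          Limits.zero_comp, Limits.comp_zero]))
    (torIso (i + 1) S.X₂ (projectiveResolution Y)).symm
    (torIso (i + 1) S.X₃ (projectiveResolution Y)).symm
    (torIso i S.X₁ (projectiveResolution Y)).symm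
    (by
      dsimp only [Iso.symm_hom]
      rw [Iso.inv_comp_eq, ← Category.assoc, Iso.eq_comp_inv, torIso_naturality_left])
    (by
      dsimp only [Iso.symm_hom]
      rw [Iso.inv_comp_eq, torConn])) h
  exact (ShortComplex.ShortExact.moduleCat_exact_iff_function_exact _).1 e

/-- The short complex attached to an exact pair of linear maps. -/
abbrev linearShortComplex {f : X' →ₗ[R] X} {g : X →ₗ[R] X''} (h : Function.Exact f g) :
    ShortComplex (ModuleCat.{u} R) :=
  ShortComplex.mk (ModuleCat.ofHom f) (ModuleCat.ofHom g) (by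
    ext x
    exact h.apply_apply_eq_zero x)

theorem linearShortComplex_shortExact {f : X' →ₗ[R] X} {g : X →ₗ[R] X''}
    (h : Function.Exact f g) (hf : Function.Injective f) (hg : Function.Surjective g) :
    (linearShortComplex h).ShortExact where
  exact := (ShortComplex.ShortExact.moduleCat_exact_iff_function_exact _).2 h
  mono_f := (ModuleCat.mono_iff_injective _).2 hf
  epi_g := (ModuleCat.epi_iff_surjective _).2 hg

/-- The connecting homomorphism for `Tor` in the first variable. -/
noncomputable def torδ {f : X' →ₗ[R] X} {g : X →ₗ[R] X''}
    (h : Function.Exact f g) (hf : Function.Injective f) (hg : Function.Surjective g) (i : ℕ)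
    (Y : Type u) [AddCommGroup Y] [Module R Y] :
    TorMod R (i + 1) X'' Y →ₗ[R] TorMod R i X' Y :=
  (torConn (linearShortComplex_shortExact h hf hg) i (ModuleCat.of R Y)).hom

section

variable {f : X' →ₗ[R] X} {g : X →ₗ[R] X''}
  (h : Function.Exact f g) (hf : Function.Injective f) (hg : Function.Surjective g) (i : ℕ)

theorem torMap_exact (h : Function.Exact f g) (hf : Function.Injective f)
    (hg : Function.Surjective g) (i : ℕ) : Function.Exact (torMap i f (LinearMap.id : Y →ₗ[R] Y))
    (torMap i g (LinearMap.id : Y →ₗ[R] Y)) := by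
  rw [torMap_id_right_eq, torMap_id_right_eq]
  exact tor_exact_middle (linearShortComplex_shortExact h hf hg) i (ModuleCat.of R Y)

theorem torδ_exact : Function.Exact (torδ h hf hg i Y)
    (torMap i f (LinearMap.id : Y →ₗ[R] Y)) := by
  rw [torMap_id_right_eq]
  exact tor_exact_left (linearShortComplex_shortExact h hf hg) i (ModuleCat.of R Y)

theorem torMap_torδ_exact : Function.Exact (torMap (i + 1) g (LinearMap.id : Y →ₗ[R] Y))
    (torδ h hf hg i Y) := by
  rw [torMap_id_right_eq]
  exact tor_exact_right (linearShortComplex_shortExact h hf hg) i (ModuleCat.of R Y)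

theorem torδ_naturality {Z Z' Z'' : Type u} [AddCommGroup Z] [Module R Z] [AddCommGroup Z']
    [Module R Z'] [AddCommGroup Z''] [Module R Z''] {f' : Z' →ₗ[R] Z} {g' : Z →ₗ[R] Z''}
    (h' : Function.Exact f' g') (hf' : Function.Injective f') (hg' : Function.Surjective g')
    (a : X' →ₗ[R] Z') (b : X →ₗ[R] Z) (c : X'' →ₗ[R] Z'') (hab : b ∘ₗ f = f' ∘ₗ a)
    (hbc : c ∘ₗ g = g' ∘ₗ b) (e : Y →ₗ[R] Y') (t : TorMod R (i + 1) X'' Y) :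
    torδ h' hf' hg' i Y' (torMap (i + 1) c e t) = torMap i a e (torδ h hf hg i Y t) := by
  have := torConn_naturality (linearShortComplex_shortExact h hf hg)
    (linearShortComplex_shortExact h' hf' hg')
    { τ₁ := ModuleCat.ofHom a
      τ₂ := ModuleCat.ofHom b
      τ₃ := ModuleCat.ofHom c
      comm₁₂ := by
        ext x
        exact (congr($hab x)).symm
      comm₂₃ := by
        ext x
        exact (congr($hbc x)).symm } i (ModuleCat.ofHom e)
  exact (congr($(this).hom t)).symm

end

attribute [irreducible] TorMod torMap torδ torZeroEquiv

end TorModule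

/-! ### Dimension shifting: scalars, the exact sequence in the second variable, and additivity of
lengths. -/

section TorModule

variable {R : Type u} [CommRing R]
variable {X X' X'' Y Y' Y'' : Type u} [AddCommGroup X] [Module R X] [AddCommGroup X'] [Module R X']
  [AddCommGroup X''] [Module R X''] [AddCommGroup Y] [Module R Y] [AddCommGroup Y'] [Module R Y']
  [AddCommGroup Y''] [Module R Y'']

theorem torδ_injective [Module.Flat R X] {f : X' →ₗ[R] X} {g : X →ₗ[R] X''}
    (h : Function.Exact f g) (hf : Function.Injective f) (hg : Function.Surjective g) (i : ℕ) :
    Function.Injective (torδ h hf hg i Y) := by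
  have := subsingleton_torMod_succ_of_flat (R := R) (X := X) (Y := Y) i
  rw [injective_iff_map_eq_zero]
  intro t ht
  obtain ⟨s, rfl⟩ := (torMap_torδ_exact h hf hg i t).1 ht
  rw [Subsingleton.elim s 0, map_zero]

theorem torδ_succ_surjective [Module.Flat R X] {f : X' →ₗ[R] X} {g : X →ₗ[R] X''}
    (h : Function.Exact f g) (hf : Function.Injective f) (hg : Function.Surjective g) (i : ℕ) :
    Function.Surjective (torδ h hf hg (i + 1) Y) := by
  have := subsingleton_torMod_succ_of_flat (R := R) (X := X) (Y := Y) i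
  intro t
  exact (torδ_exact h hf hg (i + 1) t).1 (Subsingleton.elim _ _)

/-- The input for dimension shifting: the connecting map embeds `Tor_(i+1)(X, Y)` into `Tor_i(K,
Y)`, so facts stable under passage to `K` follow from degree 0. -/
theorem exists_flat_presentation (R : Type u) [CommRing R] (X : Type u) [AddCommGroup X]
    [Module R X] : ∃ (K F : Type u) (_ : AddCommGroup K) (_ : Module R K) (_ : AddCommGroup F)
      (_ : Module R F) (k : K →ₗ[R] F) (g : F →ₗ[R] X), Module.Flat R F ∧ Function.Exact k g ∧
        Function.Injective k ∧ Function.Surjective g :=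
  ⟨LinearMap.ker (Finsupp.linearCombination R (id : X → X)), X →₀ R, inferInstance, inferInstance,
    inferInstance, inferInstance, Submodule.subtype _, Finsupp.linearCombination R id,
    inferInstance, LinearMap.exact_subtype_ker_map _, Submodule.subtype_injective _,
    Finsupp.linearCombination_id_surjective R X⟩

theorem torMap_smul_id_left (i : ℕ) (a : R) (t : TorMod R i X Y) :
    torMap i (a • LinearMap.id) LinearMap.id t = a • t := by
  induction i generalizing X with
  | zero =>
    apply (torZeroEquiv X Y).injective
    rw [torZeroEquiv_torMap, TensorProduct.map_smul_left, TensorProduct.map_id]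
    simp
  | succ i ih =>
    obtain ⟨K, F, _, _, _, _, k, g, _, hex, hk, hs⟩ := exists_flat_presentation R X
    apply torδ_injective hex hk hs i
    rw [torδ_naturality hex hk hs i hex hk hs (a • LinearMap.id)
      (a • LinearMap.id) (a • LinearMap.id) (by ext; simp) (by ext; simp), ih, map_smul]

theorem torMap_smul_id_right (i : ℕ) (a : R) (t : TorMod R i X Y) :
    torMap i LinearMap.id (a • LinearMap.id) t = a • t := by
  induction i generalizing X with
  | zero =>
    apply (torZeroEquiv X Y).injective
    rw [torZeroEquiv_torMap, TensorProduct.map_smul_right, TensorProduct.map_id]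
    simp
  | succ i ih =>
    obtain ⟨K, F, _, _, _, _, k, g, _, hex, hk, hs⟩ := exists_flat_presentation R X
    apply torδ_injective hex hk hs i
    rw [torδ_naturality hex hk hs i hex hk hs LinearMap.id
      LinearMap.id LinearMap.id (by ext; simp) (by ext; simp), ih, map_smul]

theorem torMap_smul_left (i : ℕ) (a : R) (f : X →ₗ[R] X') (g : Y →ₗ[R] Y') (t : TorMod R i X Y) :
    torMap i (a • f) g t = a • torMap i f g t := by
  have := torMap_torMap i f (a • LinearMap.id) g LinearMap.id t
  rw [torMap_smul_id_left] at this
  rw [this]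
  rfl

theorem torMap_smul_right (i : ℕ) (a : R) (f : X →ₗ[R] X') (g : Y →ₗ[R] Y')
    (t : TorMod R i X Y) : torMap i f (a • g) t = a • torMap i f g t := by
  have := torMap_torMap i f LinearMap.id g (a • LinearMap.id) t
  rw [torMap_smul_id_right] at this
  rw [this]
  rfl

theorem torMap_zero_left (i : ℕ) (g : Y →ₗ[R] Y') (t : TorMod R i X Y) :
    torMap i (0 : X →ₗ[R] X') g t = 0 := by
  have := torMap_smul_left i 0 (0 : X →ₗ[R] X') g t
  rwa [zero_smul, zero_smul] at this

theorem torMap_zero_right (i : ℕ) (f : X →ₗ[R] X') (t : TorMod R i X Y) :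
    torMap i f (0 : Y →ₗ[R] Y') t = 0 := by
  have := torMap_smul_right i 0 f (0 : Y →ₗ[R] Y') t
  rwa [zero_smul, zero_smul] at this

theorem torMap_zero_surjective {f : X →ₗ[R] X'} {g : Y →ₗ[R] Y'} (hf : Function.Surjective f)
    (hg : Function.Surjective g) : Function.Surjective (torMap 0 f g) := by
  intro t
  obtain ⟨s, hs⟩ := TensorProduct.map_surjective hf hg (torZeroEquiv X' Y' t)
  refine ⟨(torZeroEquiv X Y).symm s, (torZeroEquiv X' Y').injective ?_⟩
  rw [torZeroEquiv_torMap, LinearEquiv.apply_symm_apply, hs]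

variable {p : Y' →ₗ[R] Y} {q : Y →ₗ[R] Y''}

theorem torMap_right_injective_of_flat [Module.Flat R X] (hp : Function.Injective p) (i : ℕ) :
    Function.Injective (torMap i (LinearMap.id : X →ₗ[R] X) p) := by
  cases i with
  | zero =>
    intro s t h
    apply (torZeroEquiv X Y').injective
    apply Module.Flat.lTensor_preserves_injective_linearMap (M := X) p hp
    have := congrArg (torZeroEquiv X Y) h
    rwa [torZeroEquiv_torMap, torZeroEquiv_torMap] at this
  | succ i =>
    have := subsingleton_torMod_succ_of_flat (R := R) (X := X) (Y := Y') i
    exact Function.injective_of_subsingleton _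

theorem torMap_left_right_comm (i : ℕ) (f : X →ₗ[R] X') (g : Y →ₗ[R] Y') (t : TorMod R i X Y) :
    torMap i f LinearMap.id (torMap i LinearMap.id g t) =
      torMap i LinearMap.id g (torMap i f LinearMap.id t) := by
  rw [torMap_torMap, torMap_torMap]
  rfl

theorem torδ_torMap_right {f : X' →ₗ[R] X} {g : X →ₗ[R] X''}
    (h : Function.Exact f g) (hf : Function.Injective f) (hg : Function.Surjective g) (i : ℕ)
    (e : Y →ₗ[R] Y') (t : TorMod R (i + 1) X'' Y) :
    torδ h hf hg i Y' (torMap (i + 1) LinearMap.id e t) =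
      torMap i LinearMap.id e (torδ h hf hg i Y t) :=
  torδ_naturality h hf hg i h hf hg LinearMap.id LinearMap.id LinearMap.id rfl rfl e t

/-- Exactness of `Tor_i(X, -)` in the middle. -/
theorem torMap_right_exact (hpq : Function.Exact p q) (hp : Function.Injective p)
    (hq : Function.Surjective q) (i : ℕ) :
    Function.Exact (torMap i (LinearMap.id : X →ₗ[R] X) p)
      (torMap i (LinearMap.id : X →ₗ[R] X) q) := by
  intro t
  constructor
  swap
  · rintro ⟨s, rfl⟩
    rw [torMap_torMap, hpq.linearMap_comp_eq_zero, torMap_zero_right]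
  intro ht
  induction i generalizing X with
  | zero =>
    have h := congrArg (torZeroEquiv X Y'') ht
    rw [torZeroEquiv_torMap, map_zero] at h
    obtain ⟨s, hs⟩ := (lTensor_exact X hpq hq _).1 h
    refine ⟨(torZeroEquiv X Y').symm s, (torZeroEquiv X Y).injective ?_⟩
    rw [torZeroEquiv_torMap, LinearEquiv.apply_symm_apply]
    exact hs
  | succ i ih =>
    obtain ⟨K, F, _, _, _, _, k, g, _, hex, hk, hs⟩ := exists_flat_presentation R X
    have h1 := congrArg (torδ hex hk hs i Y'') ht
    rw [torδ_torMap_right, map_zero] at h1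
    obtain ⟨v, hv⟩ := ih _ h1
    -- Flatness of `F` makes `Tor_i(F, Y') → Tor_i(F, Y)` injective, so vanishing may be tested in
    -- `Tor_i(F, Y)`; then `v` comes from `Tor_(i+1)(X, Y')`.
    have h2 : torMap i k LinearMap.id v = 0 := by
      apply torMap_right_injective_of_flat hp i
      rw [← torMap_left_right_comm, hv, map_zero]
      exact (torδ_exact hex hk hs i).apply_apply_eq_zero t
    obtain ⟨s, rfl⟩ := (torδ_exact hex hk hs i v).1 h2
    refine ⟨s, torδ_injective hex hk hs i ?_⟩
    rw [torδ_torMap_right, hv]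

/-- The connecting homomorphism for `Tor` in the second variable. -/
theorem exists_tor_connecting_right (hpq : Function.Exact p q) (hp : Function.Injective p)
    (hq : Function.Surjective q) (i : ℕ) :
    ∃ d : TorMod R (i + 1) X Y'' →ₗ[R] TorMod R i X Y',
      Function.Exact (torMap (i + 1) LinearMap.id q) d ∧
        Function.Exact d (torMap i LinearMap.id p) := by
  induction i generalizing X with
  | zero =>
    have hcomm {Z Z' : Type u} [AddCommGroup Z] [Module R Z] [AddCommGroup Z'] [Module R Z']
        {A A' : Type u} [AddCommGroup A] [Module R A] [AddCommGroup A'] [Module R A']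
        (f : A →ₗ[R] A') (e : Z →ₗ[R] Z') : torMap 0 f LinearMap.id ∘ₗ torMap 0 LinearMap.id e =
          torMap 0 LinearMap.id e ∘ₗ torMap 0 f LinearMap.id :=
      LinearMap.ext fun t => torMap_left_right_comm 0 f e t
    obtain ⟨K, F, _, _, _, _, k, g, _, hex, hk, hs⟩ := exists_flat_presentation R X
    let k₁ := torMap 0 k (LinearMap.id : Y' →ₗ[R] Y')
    let k₂ := torMap 0 k (LinearMap.id : Y →ₗ[R] Y)
    let k₃ := torMap 0 k (LinearMap.id : Y'' →ₗ[R] Y'')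
    -- Snake lemma for the rows `K ⊗ -` and `F ⊗ -`: the kernel of `k₃` is `Tor_1(X, Y'')` and the
    -- cokernel of `k₁` is `Tor_0(X, Y')`.
    refine ⟨SnakeLemma.δ' k₁ k₂ k₃ (torMap 0 LinearMap.id p) (torMap 0 LinearMap.id q)
      (torMap_right_exact hpq hp hq 0) (torMap 0 LinearMap.id p) (torMap 0 LinearMap.id q)
      (torMap_right_exact hpq hp hq 0) (hcomm _ _).symm (hcomm _ _).symm
      (torδ hex hk hs 0 Y'') (torδ_exact hex hk hs 0)
      (torMap 0 g LinearMap.id) (torMap_exact hex hk hs 0)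
      (torMap_zero_surjective Function.surjective_id hq)
      (torMap_right_injective_of_flat hp 0), ?_, ?_⟩
    · exact SnakeLemma.exact_δ'_right _ _ _ _ _ _ _ _ _ _ _ (torδ hex hk hs 0 Y)
        (torδ_exact hex hk hs 0) _ _ _ _ _ _ _
        (LinearMap.ext fun t => (torδ_torMap_right hex hk hs 0 q t).symm)
        (torδ_injective hex hk hs 0)
    · exact SnakeLemma.exact_δ'_left _ _ _ _ _ _ _ _ _ _ _ _ _ _ _
        (torMap 0 g LinearMap.id) (torMap_exact hex hk hs 0) _ _ _
        (hcomm _ _).symm (torMap_zero_surjective hs Function.surjective_id)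
  | succ i ih =>
    obtain ⟨K, F, _, _, _, _, k, g, _, hex, hk, hs⟩ := exists_flat_presentation R X
    obtain ⟨d, hd1, hd2⟩ := ih (X := K)
    let D := torδ hex hk hs
    -- The connecting map `d` for `K` is transported to `X`: its values die in `Tor_i(F, Y')`, hence
    -- factor uniquely through the injection `D i Y'`.
    have hmem (t : TorMod R (i + 2) X Y'') :
        (d ∘ₗ D (i + 1) Y'') t ∈ LinearMap.range (D i Y') := by
      refine (torδ_exact hex hk hs i _).1 ?_
      apply torMap_right_injective_of_flat hp i
      rw [← torMap_left_right_comm, map_zero]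
      simp only [LinearMap.comp_apply]
      rw [hd2.apply_apply_eq_zero, map_zero]
    have hinj : Function.Injective (D i Y') := torδ_injective hex hk hs i
    let e := LinearEquiv.ofInjective (D i Y') hinj
    let d' := e.symm.toLinearMap ∘ₗ LinearMap.codRestrict _ (d ∘ₗ D (i + 1) Y'') hmem
    have hd' (t) : D i Y' (d' t) = d (D (i + 1) Y'' t) := by
      have : e (d' t) = LinearMap.codRestrict _ (d ∘ₗ D (i + 1) Y'') hmem t :=
        e.apply_symm_apply _
      exact congrArg Subtype.val this
    refine ⟨d', fun t => ?_, fun t => ?_⟩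
    · rw [← hinj.eq_iff, hd', map_zero, hd1]
      constructor
      · rintro ⟨s, hs'⟩
        obtain ⟨r, rfl⟩ := torδ_succ_surjective hex hk hs i s
        refine ⟨r, torδ_injective hex hk hs (i + 1) ?_⟩
        rw [torδ_torMap_right]
        exact hs'
      · rintro ⟨s, rfl⟩
        exact ⟨D (i + 1) Y s, (torδ_torMap_right hex hk hs (i + 1) q s).symm⟩
    · rw [← (torδ_injective hex hk hs i (Y := Y)).eq_iff, torδ_torMap_right, map_zero, hd2]
      constructor
      · rintro ⟨s, hs'⟩
        obtain ⟨r, rfl⟩ := torδ_succ_surjective hex hk hs i s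
        refine ⟨r, hinj ?_⟩
        rw [hd']
        exact hs'
      · rintro ⟨s, rfl⟩
        exact ⟨_, (hd' s).symm⟩

theorem torLength_zero_sub_one : torLength R (((0 : ℕ) : ℤ) - 1) X Y = 0 :=
  rfl

theorem torLength_succ_sub_one (j : ℕ) :
    torLength R (((j + 1 : ℕ) : ℤ) - 1) X Y = Module.length R (TorMod R j X Y) := by
  rw [← torLength_natCast]
  congr 1
  push_cast
  ring

theorem torLength_congr (i : ℤ) (e : X ≃ₗ[R] X') (e' : Y ≃ₗ[R] Y') :
    torLength R i X Y = torLength R i X' Y' := by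
  cases i with
  | ofNat i =>
    rw [Int.ofNat_eq_natCast, torLength_natCast, torLength_natCast]
    exact (torEquiv i e e').length_eq
  | negSucc i => rfl

/-- Additivity of the length of `Tor` in the first variable when the maps induced by the inclusion
vanish. -/
theorem torLength_eq_add_left {f : X' →ₗ[R] X} {g : X →ₗ[R] X''} (h : Function.Exact f g)
    (hf : Function.Injective f) (hg : Function.Surjective g) (i : ℕ)
    (hz : ∀ j ≤ i, ∀ t : TorMod R j X' Y, torMap j f LinearMap.id t = 0) :
    torLength R i X'' Y = torLength R i X Y + torLength R ((i : ℤ) - 1) X' Y := by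
  have hinj : Function.Injective (torMap i g (LinearMap.id : Y →ₗ[R] Y)) := by
    rw [injective_iff_map_eq_zero]
    intro t ht
    obtain ⟨s, rfl⟩ := (torMap_exact h hf hg i t).1 ht
    exact hz i le_rfl s
  cases i with
  | zero =>
    rw [torLength_zero_sub_one, add_zero, torLength_natCast, torLength_natCast]
    exact (LinearEquiv.ofBijective _ ⟨hinj,
      torMap_zero_surjective hg Function.surjective_id⟩).length_eq.symm
  | succ j =>
    rw [torLength_succ_sub_one, torLength_natCast, torLength_natCast]
    exact Module.length_eq_add_of_exact _ _ hinj
      (fun t => (torδ_exact h hf hg j t).1 (hz j j.le_succ t)) (torMap_torδ_exact h hf hg j)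

/-- Additivity of the length of `Tor` in the second variable when the maps induced by the inclusion
vanish. -/
theorem torLength_eq_add_right (hpq : Function.Exact p q) (hp : Function.Injective p)
    (hq : Function.Surjective q) (i : ℕ)
    (hz : ∀ j ≤ i, ∀ t : TorMod R j X Y', torMap j LinearMap.id p t = 0) :
    torLength R i X Y'' = torLength R i X Y + torLength R ((i : ℤ) - 1) X Y' := by
  have hinj : Function.Injective (torMap i (LinearMap.id : X →ₗ[R] X) q) := by
    rw [injective_iff_map_eq_zero]
    intro t ht
    obtain ⟨s, rfl⟩ := (torMap_right_exact hpq hp hq i t).1 ht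
    exact hz i le_rfl s
  cases i with
  | zero =>
    rw [torLength_zero_sub_one, add_zero, torLength_natCast, torLength_natCast]
    exact (LinearEquiv.ofBijective _ ⟨hinj,
      torMap_zero_surjective Function.surjective_id hq⟩).length_eq.symm
  | succ j =>
    rw [torLength_succ_sub_one, torLength_natCast, torLength_natCast]
    obtain ⟨d, hd1, hd2⟩ := exists_tor_connecting_right (X := X) hpq hp hq j
    exact Module.length_eq_add_of_exact _ _ hinj
      (fun t => (hd2 t).1 (hz j j.le_succ t)) hd1

end TorModule

/-! ### Chain conditions on Tor of modules over two algebras. -/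

section StableNoetherian

variable {R : Type u} [CommRing R]

/-- The ascending chain condition for the submodules stable under a family of endomorphisms. -/
def StableNoetherian {ι T : Type*} [AddCommGroup T] [Module R T] (φ : ι → Module.End R T) : Prop :=
  ∀ U : ℕ → Submodule R T, Monotone U → (∀ n j, U n ≤ (U n).comap (φ j)) → ∃ k, ∀ n ≥ k, U n = U k

theorem StableNoetherian.of_injective {ι T T' : Type*} [AddCommGroup T] [Module R T]
    [AddCommGroup T'] [Module R T'] {φ : ι → Module.End R T} {φ' : ι → Module.End R T'}
    (h : StableNoetherian φ') (f : T →ₗ[R] T') (hf : Function.Injective f)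
    (hφ : ∀ j t, f (φ j t) = φ' j (f t)) : StableNoetherian φ := by
  intro U hU hs
  obtain ⟨k, hk⟩ := h (fun n => (U n).map f) (fun m n hmn => Submodule.map_mono (hU hmn)) (by
    rintro n j _ ⟨t, ht, rfl⟩
    exact ⟨φ j t, hs n j ht, hφ j t⟩)
  exact ⟨k, fun n hn => Submodule.map_injective_of_injective hf (hk n hn)⟩

variable {σ τ : Type*} {A B : Type u} [CommRing A] [CommRing B] [Algebra R A] [Algebra R B]

/-- The algebra homomorphism giving the action of `A ⊗ B` on `V ⊗ W`. -/
noncomputable abbrev tensorAction (R A B V W : Type u) [CommRing R] [CommRing A] [CommRing B]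
    [Algebra R A] [Algebra R B] [AddCommGroup V] [Module R V] [Module A V] [IsScalarTower R A V]
    [AddCommGroup W] [Module R W] [Module B W] [IsScalarTower R B W] :
    A ⊗[R] B →ₐ[R] Module.End R (V ⊗[R] W) :=
  (Module.endTensorEndAlgHom (R := R) (S := R) (A := R) (M := V) (N := W)).comp
    (Algebra.TensorProduct.map (Algebra.lsmul R R V) (Algebra.lsmul R R W))

theorem tensorAction_tmul {V W : Type u} [AddCommGroup V] [Module R V] [Module A V]
    [IsScalarTower R A V] [AddCommGroup W] [Module R W] [Module B W] [IsScalarTower R B W]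
    (a : A) (b : B) : tensorAction R A B V W (a ⊗ₜ b) =
      TensorProduct.map (Algebra.lsmul R R V a) (Algebra.lsmul R R W b) := by
  ext v w
  simp [tensorAction, Module.endTensorEndAlgHom_apply]

variable {x : σ → A} {y : τ → B} {V W : Type u} [AddCommGroup V] [Module R V] [Module A V]
  [IsScalarTower R A V] [AddCommGroup W] [Module R W] [Module B W] [IsScalarTower R B W]

/-- The elements of `A ⊗ B` that preserve `U` form a subalgebra, which contains both sets of
generators. -/
theorem tensorAction_mem (hx : Algebra.adjoin R (Set.range x) = ⊤)
    (hy : Algebra.adjoin R (Set.range y) = ⊤) {U : Submodule R (V ⊗[R] W)}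
    (hUx : ∀ i, U ≤ U.comap (TensorProduct.map (Algebra.lsmul R R V (x i)) LinearMap.id))
    (hUy : ∀ j, U ≤ U.comap (TensorProduct.map LinearMap.id (Algebra.lsmul R R W (y j))))
    (z : A ⊗[R] B) {t : V ⊗[R] W} (ht : t ∈ U) : tensorAction R A B V W z t ∈ U := by
  let S : Subalgebra R (A ⊗[R] B) :=
    { carrier := {z | ∀ t ∈ U, tensorAction R A B V W z t ∈ U}
      mul_mem' := fun {a b} ha hb t ht => by
        rw [map_mul]
        exact ha _ (hb _ ht)
      add_mem' := fun {a b} ha hb t ht => by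
        rw [map_add]
        exact U.add_mem (ha _ ht) (hb _ ht)
      algebraMap_mem' := fun r t ht => by
        rw [AlgHom.commutes]
        exact U.smul_mem r ht }
  have h1 : (⊤ : Subalgebra R A) ≤ S.comap Algebra.TensorProduct.includeLeft := by
    rw [← hx, Algebra.adjoin_le_iff]
    rintro _ ⟨i, rfl⟩ t ht
    have := hUx i ht
    change tensorAction R A B V W (x i ⊗ₜ 1) t ∈ U
    rw [tensorAction_tmul, map_one]
    exact this
  have h2 : (⊤ : Subalgebra R B) ≤ S.comap Algebra.TensorProduct.includeRight := by
    rw [← hy, Algebra.adjoin_le_iff]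
    rintro _ ⟨i, rfl⟩ t ht
    have := hUy i ht
    change tensorAction R A B V W (1 ⊗ₜ y i) t ∈ U
    rw [tensorAction_tmul, map_one]
    exact this
  suffices z ∈ S from this t ht
  induction z with
  | zero => exact S.zero_mem
  | add a b ha hb => exact S.add_mem ha hb
  | tmul a b =>
    have := S.mul_mem (h1 (Algebra.mem_top (x := a))) (h2 (Algebra.mem_top (x := b)))
    simpa using this

/-- Submodules stable under the generators are exactly `A ⊗ B`-submodules, and `V ⊗ W` is finite
over this Noetherian ring. -/
theorem stableNoetherian_tensorProduct [IsNoetherianRing (A ⊗[R] B)] [Module.Finite A V]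
    [Module.Finite B W] (hx : Algebra.adjoin R (Set.range x) = ⊤)
    (hy : Algebra.adjoin R (Set.range y) = ⊤) :
    StableNoetherian (Sum.elim
      (fun i => TensorProduct.map (Algebra.lsmul R R V (x i)) LinearMap.id)
      (fun j => TensorProduct.map LinearMap.id (Algebra.lsmul R R W (y j))) :
      σ ⊕ τ → Module.End R (V ⊗[R] W)) := by
  let _ : Module (A ⊗[R] B) (V ⊗[R] W) :=
    Module.compHom _ (tensorAction R A B V W : A ⊗[R] B →+* Module.End R (V ⊗[R] W))
  have hsmul (z : A ⊗[R] B) (t : V ⊗[R] W) : z • t = tensorAction R A B V W z t := rfl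
  have hfin : Module.Finite (A ⊗[R] B) (V ⊗[R] W) := by
    obtain ⟨s, hs⟩ := (Module.Finite.fg_top : (⊤ : Submodule A V).FG)
    obtain ⟨s', hs'⟩ := (Module.Finite.fg_top : (⊤ : Submodule B W).FG)
    let N := Submodule.span (A ⊗[R] B) (Set.image2 (fun v w => v ⊗ₜ[R] w) (s : Set V) (s' : Set W))
    refine ⟨Submodule.fg_def.2 ⟨_, Set.Finite.image2 _ s.finite_toSet s'.finite_toSet,
      (Submodule.eq_top_iff'.2 fun t => ?_ : N = ⊤)⟩⟩
    induction t with
    | zero => exact N.zero_mem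
    | add a b ha hb => exact N.add_mem ha hb
    | tmul v w =>
      have hv : v ∈ Submodule.span A (s : Set V) := hs ▸ Submodule.mem_top
      have hw : w ∈ Submodule.span B (s' : Set W) := hs' ▸ Submodule.mem_top
      induction hv using Submodule.span_induction with
      | zero => rw [TensorProduct.zero_tmul]; exact N.zero_mem
      | add a b _ _ ha hb => rw [TensorProduct.add_tmul]; exact N.add_mem ha hb
      | smul a v _ h =>
        have := N.smul_mem (a ⊗ₜ[R] (1 : B)) h
        rw [hsmul, tensorAction_tmul] at this
        simpa using this
      | mem v hv =>
        induction hw using Submodule.span_induction with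
        | zero => rw [TensorProduct.tmul_zero]; exact N.zero_mem
        | add a b _ _ ha hb => rw [TensorProduct.tmul_add]; exact N.add_mem ha hb
        | smul b w _ h =>
          have := N.smul_mem ((1 : A) ⊗ₜ[R] b) h
          rw [hsmul, tensorAction_tmul] at this
          simpa using this
        | mem w hw => exact Submodule.subset_span ⟨v, hv, w, hw, rfl⟩
  intro U hU hs
  let U' : ℕ →o Submodule (A ⊗[R] B) (V ⊗[R] W) :=
    { toFun := fun n =>
        { carrier := U n
          add_mem' := (U n).add_mem
          zero_mem' := (U n).zero_mem
          smul_mem' := fun z t ht => tensorAction_mem hx hy (fun i => hs n (Sum.inl i))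
            (fun j => hs n (Sum.inr j)) z ht }
      monotone' := fun m n h => hU h }
  obtain ⟨k, hk⟩ := monotone_stabilizes_iff_noetherian.2
    (inferInstance : IsNoetherian (A ⊗[R] B) (V ⊗[R] W)) U'
  refine ⟨k, fun n hn => ?_⟩
  ext t
  exact (SetLike.ext_iff.1 (hk n hn) t).symm

/-- Freeness of `A` over `R` makes a finite free `A`-module flat over `R`. One presentation thus
shifts Tor over `R` while keeping the kernel finite over `A`. -/
theorem exists_free_presentation_finite [IsNoetherianRing A] [Module.Free R A] (V : Type u)
    [AddCommGroup V] [Module R V] [Module A V] [IsScalarTower R A V] [Module.Finite A V] :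
    ∃ (K F : Type u) (_ : AddCommGroup K) (_ : Module R K) (_ : Module A K)
      (_ : IsScalarTower R A K) (_ : AddCommGroup F) (_ : Module R F) (_ : Module A F)
      (_ : IsScalarTower R A F) (k : K →ₗ[A] F) (g : F →ₗ[A] V), Module.Flat R F ∧
        Module.Finite A K ∧ Function.Exact k g ∧ Function.Injective k ∧ Function.Surjective g := by
  obtain ⟨n, g, hg⟩ := Module.Finite.exists_fin' A V
  exact ⟨LinearMap.ker g, Fin n → A, inferInstance, inferInstance, inferInstance, inferInstance,
    inferInstance, inferInstance, inferInstance, inferInstance, Submodule.subtype _, g,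
    inferInstance, inferInstance, LinearMap.exact_subtype_ker_map _,
    Submodule.subtype_injective _, hg⟩

/-- `Tor_i(V, W)` satisfies the ascending chain condition for submodules stable under the
generators of the algebras acting on `V` and `W`. -/
theorem stableNoetherian_tor [IsNoetherianRing (A ⊗[R] B)] [IsNoetherianRing A] [Module.Free R A]
    [Module.Finite A V] [Module.Finite B W] (hx : Algebra.adjoin R (Set.range x) = ⊤)
    (hy : Algebra.adjoin R (Set.range y) = ⊤) (i : ℕ) :
    StableNoetherian (Sum.elim
      (fun j => torMap i (Algebra.lsmul R R V (x j)) LinearMap.id)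
      (fun j => torMap i LinearMap.id (Algebra.lsmul R R W (y j))) :
      σ ⊕ τ → Module.End R (TorMod R i V W)) := by
  induction i generalizing V with
  | zero =>
    refine (stableNoetherian_tensorProduct (V := V) (W := W) hx hy).of_injective
      (torZeroEquiv V W).toLinearMap (torZeroEquiv V W).injective ?_
    rintro (j | j) t <;> exact torZeroEquiv_torMap _ _ t
  | succ i ih =>
    obtain ⟨K, F, _, _, _, _, _, _, _, _, k, g, _, _, hex, hk, hg⟩ :=
      exists_free_presentation_finite (R := R) (A := A) V
    have hex' : Function.Exact (k.restrictScalars R) (g.restrictScalars R) := hex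
    have hk' : Function.Injective (k.restrictScalars R) := hk
    have hg' : Function.Surjective (g.restrictScalars R) := hg
    -- The chain condition passes to `Tor_(i+1)(V, W)` because the connecting map is injective and
    -- commutes with both sets of operators.
    refine (ih (V := K)).of_injective (torδ hex' hk' hg' i W)
      (torδ_injective hex' hk' hg' i) ?_
    rintro (j | j) t
    · exact torδ_naturality hex' hk' hg' i hex' hk' hg' _ (Algebra.lsmul R R F (x j)) _
        (by ext; simp) (by ext; simp) _ t
    · exact torδ_torMap_right hex' hk' hg' i _ t

theorem isNoetherian_torMod [IsNoetherianRing R] (i : ℕ) (X Y : Type u) [AddCommGroup X]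
    [Module R X] [AddCommGroup Y] [Module R Y] [Module.Finite R X] [Module.Finite R Y] :
    IsNoetherian R (TorMod R i X Y) := by
  -- With `A = B = R` and no generators, every submodule is stable.
  have h0 : Algebra.adjoin R (Set.range (PEmpty.elim : PEmpty.{u + 1} → R)) = ⊤ :=
    Algebra.eq_top_iff.2 fun r => Subalgebra.algebraMap_mem _ r
  have : IsNoetherianRing (R ⊗[R] R) :=
    isNoetherianRing_of_ringEquiv R (Algebra.TensorProduct.lid R R).symm.toRingEquiv
  rw [← monotone_stabilizes_iff_noetherian]
  intro U
  obtain ⟨k, hk⟩ := stableNoetherian_tor (V := X) (W := Y) h0 h0 i U U.monotone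
    (by rintro n (j | j) <;> exact j.elim)
  exact ⟨k, fun n hn => (hk n hn).symm⟩

end StableNoetherian

/-! ### Rees modules and the bigraded family of Tor modules. -/

section ReesFamily

variable {R : Type u} [CommRing R]

/-- A family of submodules stable under two families of degree-raising operators. -/
def StableFamily {σ τ : Type*} {E : ℕ → ℕ → Type*} [∀ n m, AddCommGroup (E n m)]
    [∀ n m, Module R (E n m)] (x : σ → ∀ n m, E n m →ₗ[R] E (n + 1) m)
    (y : τ → ∀ n m, E n m →ₗ[R] E n (m + 1)) (U : ∀ n m, Submodule R (E n m)) : Prop :=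
  (∀ j n m, U n m ≤ (U (n + 1) m).comap (x j n m)) ∧
    ∀ j n m, U n m ≤ (U n (m + 1)).comap (y j n m)

/-- The ascending chain condition for stable families of submodules. -/
def FamilyNoetherian {σ τ : Type*} {E : ℕ → ℕ → Type*} [∀ n m, AddCommGroup (E n m)]
    [∀ n m, Module R (E n m)] (x : σ → ∀ n m, E n m →ₗ[R] E (n + 1) m)
    (y : τ → ∀ n m, E n m →ₗ[R] E n (m + 1)) : Prop :=
  ∀ U : ℕ → ∀ n m, Submodule R (E n m), Monotone U → (∀ k, StableFamily x y (U k)) →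
    ∃ k, ∀ l ≥ k, U l = U k

/-- Multiplication by an element of `I` as a map `I ^ n M → I ^ (n + 1) M`. -/
def reesMul {I : Ideal R} (M : Type u) [AddCommGroup M] [Module R M] (a : I) (n : ℕ) :
    ↥(I ^ n • (⊤ : Submodule R M)) →ₗ[R] ↥(I ^ (n + 1) • (⊤ : Submodule R M)) :=
  (LinearMap.lsmul R M a).restrict fun m hm => by
    rw [pow_succ', Submodule.mul_smul]
    exact Submodule.smul_mem_smul a.2 hm

variable {I : Ideal R} {r : ℕ} {a : Fin r → I}

/-- Replaces the Rees algebra, which need not be flat over `R`, by a polynomial ring, which is free.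
-/
theorem reesAlgebra_aeval_surjective (ha : Ideal.span (Set.range fun j => (a j : R)) = I) :
    Function.Surjective (MvPolynomial.aeval (R := R) fun j =>
      (⟨Polynomial.monomial 1 (a j : R), reesAlgebra.monomial_mem.2 (by simp)⟩ :
        reesAlgebra I)) := by
  have h : Algebra.adjoin R (Set.range fun j => Polynomial.monomial 1 (a j : R)) =
      reesAlgebra I := by
    rw [← adjoin_monomial_eq_reesAlgebra]
    conv_rhs => rw [← ha]
    change _ = Algebra.adjoin R ((Submodule.map (Polynomial.monomial 1)
      (Submodule.span R (Set.range fun j => (a j : R))) : Submodule R (Polynomial R)) :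
        Set (Polynomial R))
    rw [Submodule.map_span, Algebra.adjoin_span, ← Set.range_comp]
    rfl
  intro f
  have hf : (f : Polynomial R) ∈ Algebra.adjoin R
      (Set.range fun j => Polynomial.monomial 1 (a j : R)) := by
    rw [h]
    exact f.2
  rw [Algebra.adjoin_range_eq_range_aeval] at hf
  obtain ⟨p, hp⟩ := hf
  refine ⟨p, Subtype.ext (Eq.trans ?_ hp)⟩
  exact MvPolynomial.comp_aeval_apply (φ := (reesAlgebra I).val) (p := p) ..

/-- The Rees module of `M` as a finite module over a polynomial ring. -/
theorem exists_rees_module (M : Type u) [AddCommGroup M] [Module R M] [Module.Finite R M]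
    [IsNoetherianRing R] (ha : Ideal.span (Set.range fun j => (a j : R)) = I) :
    ∃ (V : Type u) (_ : AddCommGroup V) (_ : Module R V) (_ : Module (MvPolynomial (Fin r) R) V)
      (_ : IsScalarTower R (MvPolynomial (Fin r) R) V)
      (ι : ∀ n, ↥(I ^ n • (⊤ : Submodule R M)) →ₗ[R] V)
      (π : ∀ n, V →ₗ[R] ↥(I ^ n • (⊤ : Submodule R M))),
      Module.Finite (MvPolynomial (Fin r) R) V ∧ (∀ n, π n ∘ₗ ι n = LinearMap.id) ∧
      (∀ n m, n ≠ m → π n ∘ₗ ι m = 0) ∧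
      ∀ j n, Algebra.lsmul R R V (MvPolynomial.X j : MvPolynomial (Fin r) R) ∘ₗ ι n =
        ι (n + 1) ∘ₗ reesMul M (a j) n := by
  let F := I.stableFiltration (⊤ : Submodule R M)
  let V := F.submodule
  let θ : MvPolynomial (Fin r) R →ₐ[R] reesAlgebra I := MvPolynomial.aeval (R := R) fun j =>
      (⟨Polynomial.monomial 1 (a j : R), reesAlgebra.monomial_mem.2 (by simp)⟩ :
        reesAlgebra I)
  have hθ : Function.Surjective θ := reesAlgebra_aeval_surjective ha
  let _ : Module (MvPolynomial (Fin r) R) V := Module.compHom V θ.toRingHom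
  have hsmul (p : MvPolynomial (Fin r) R) (v : V) : p • v = θ p • v := rfl
  have htower : IsScalarTower R (MvPolynomial (Fin r) R) V := ⟨fun s p v => by
    rw [hsmul, hsmul, map_smul, smul_assoc]⟩
  have hfin : Module.Finite (reesAlgebra I) V := by
    rw [Module.Finite.iff_fg]
    exact (Ideal.Filtration.submodule_fg_iff_stable F
      (fun i => IsNoetherian.noetherian _)).2 (I.stableFiltration_stable _)
  let ι (n : ℕ) : ↥(I ^ n • (⊤ : Submodule R M)) →ₗ[R] V :=
    { toFun := fun v => ⟨PolynomialModule.single R n v, fun i => by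
        rw [PolynomialModule.coeff_single, Finsupp.single_apply]
        split_ifs with h
        · subst h
          exact v.2
        · exact Submodule.zero_mem _⟩
      map_add' := fun v w => Subtype.ext ((PolynomialModule.lsingle R n).map_add v.1 w.1)
      map_smul' := fun s v => Subtype.ext ((PolynomialModule.lsingle R n).map_smul s v.1) }
  let π (n : ℕ) : V →ₗ[R] ↥(I ^ n • (⊤ : Submodule R M)) :=
    { toFun := fun v => ⟨v.1.coeff n, v.2 n⟩
      map_add' := fun v w => rfl
      map_smul' := fun s v => rfl }
  refine ⟨V, inferInstance, inferInstance, inferInstance, htower, ι, π, ?_, ?_, ?_, ?_⟩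
  · let _ : Algebra (MvPolynomial (Fin r) R) (reesAlgebra I) := θ.toRingHom.toAlgebra
    have : IsScalarTower (MvPolynomial (Fin r) R) (reesAlgebra I) V := ⟨fun p f v => by
      rw [hsmul, Algebra.smul_def, mul_smul]
      rfl⟩
    have : Module.Finite (MvPolynomial (Fin r) R) (reesAlgebra I) :=
      Module.Finite.of_surjective (Algebra.linearMap (MvPolynomial (Fin r) R) (reesAlgebra I)) hθ
    exact Module.Finite.trans (reesAlgebra I) V
  · intro n
    refine LinearMap.ext fun v => Subtype.ext ?_
    exact Finsupp.single_eq_same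
  · intro n m hnm
    refine LinearMap.ext fun v => Subtype.ext ?_
    exact Finsupp.single_eq_of_ne hnm
  · intro j n
    ext v : 1
    apply Subtype.ext
    have h1 : (MvPolynomial.X j : MvPolynomial (Fin r) R) • ι n v =
      (⟨Polynomial.monomial 1 (a j : R), reesAlgebra.monomial_mem.2 (by simp)⟩ :
        reesAlgebra I) • ι n v := by
      rw [hsmul, MvPolynomial.aeval_X]
    refine (congrArg Subtype.val h1).trans ?_
    change Polynomial.monomial 1 (a j : R) • PolynomialModule.single R n v.1 = _
    rw [PolynomialModule.monomial_smul_single, add_comm]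
    rfl

theorem familyNoetherian_tor {J : Ideal R} {s : ℕ} {b : Fin s → J} [IsNoetherianRing R]
    (M N : Type u) [AddCommGroup M] [Module R M] [Module.Finite R M] [AddCommGroup N] [Module R N]
    [Module.Finite R N] (ha : Ideal.span (Set.range fun j => (a j : R)) = I)
    (hb : Ideal.span (Set.range fun j => (b j : R)) = J) (i : ℕ) :
    FamilyNoetherian
      (E := fun n m => TorMod R i ↥(I ^ n • (⊤ : Submodule R M)) ↥(J ^ m • (⊤ : Submodule R N)))
      (fun j n _ => torMap i (reesMul M (a j) n) LinearMap.id)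
      (fun j _ m => torMap i LinearMap.id (reesMul N (b j) m)) := by
  obtain ⟨V, _, _, _, _, ι, π, _, h1, h0, hX⟩ := exists_rees_module M ha
  obtain ⟨W, _, _, _, _, ι', π', _, h1', h0', hX'⟩ := exists_rees_module N hb
  have : IsNoetherianRing (MvPolynomial (Fin r) R ⊗[R] MvPolynomial (Fin s) R) :=
    Algebra.FiniteType.isNoetherianRing (MvPolynomial (Fin r) R) _
  have hT := stableNoetherian_tor (R := R) (V := V) (W := W)
    (MvPolynomial.adjoin_range_X (σ := Fin r)) (MvPolynomial.adjoin_range_X (σ := Fin s)) i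
  intro U hU hs
  -- A stable family is assembled into one stable submodule of Tor of the Rees modules; the
  -- projections `π` recover its components, so stabilization of `T` gives that of `U`.
  let T (k : ℕ) : Submodule R (TorMod R i V W) :=
    ⨆ n, ⨆ m, (U k n m).map (torMap i (ι n) (ι' m))
  have hTU (k n m) : U k n m = (T k).map (torMap i (π n) (π' m)) := by
    apply le_antisymm
    · have : U k n m = ((U k n m).map (torMap i (ι n) (ι' m))).map (torMap i (π n) (π' m)) := by
        rw [← Submodule.map_comp, ← torMap_comp, h1, h1', torMap_id, Submodule.map_id]
      refine this.le.trans (Submodule.map_mono ?_)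
      exact le_iSup₂ (f := fun n m => (U k n m).map (torMap i (ι n) (ι' m))) n m
    · simp only [T, Submodule.map_iSup, iSup_le_iff, ← Submodule.map_comp, ← torMap_comp]
      intro n' m'
      by_cases hn : n = n'
      · subst hn
        by_cases hm : m = m'
        · subst hm
          rw [h1, h1', torMap_id, Submodule.map_id]
        · rw [h0' m m' hm]
          rintro _ ⟨t, -, rfl⟩
          rw [torMap_zero_right]
          exact Submodule.zero_mem _
      · rw [h0 n n' hn]
        rintro _ ⟨t, -, rfl⟩
        rw [torMap_zero_left]
        exact Submodule.zero_mem _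
  obtain ⟨k, hk⟩ := hT T
    (fun k l hkl => iSup₂_mono fun n m => Submodule.map_mono (hU hkl n m)) (by
      rintro k (j | j)
      · refine iSup₂_le fun n m => ?_
        rintro _ ⟨t, ht, rfl⟩
        change torMap i _ _ (torMap i (ι n) (ι' m) t) ∈ T k
        rw [torMap_torMap, hX, LinearMap.id_comp]
        refine Submodule.mem_iSup_of_mem (n + 1) (Submodule.mem_iSup_of_mem m
          ⟨torMap i (reesMul M (a j) n) LinearMap.id t, (hs k).1 j n m ht, ?_⟩)
        rw [torMap_torMap, LinearMap.comp_id]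
      · refine iSup₂_le fun n m => ?_
        rintro _ ⟨t, ht, rfl⟩
        change torMap i _ _ (torMap i (ι n) (ι' m) t) ∈ T k
        rw [torMap_torMap, hX', LinearMap.id_comp]
        refine Submodule.mem_iSup_of_mem n (Submodule.mem_iSup_of_mem (m + 1)
          ⟨torMap i LinearMap.id (reesMul N (b j) m) t, (hs k).2 j n m ht, ?_⟩)
        rw [torMap_torMap, LinearMap.comp_id])
  refine ⟨k, fun l hl => ?_⟩
  funext n m
  rw [hTU, hTU, hk l hl]

end ReesFamily

/-! ### Eventually polynomial functions of two variables. -/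

section EventuallyPolynomialFunctions

/-- A rational valued function of two natural numbers which is eventually polynomial. -/
def EventuallyPoly (f : ℕ → ℕ → ℚ) : Prop :=
  ∃ p : MvPolynomial (Fin 2) ℚ, ∃ k : ℕ, ∀ n m : ℕ, k ≤ n → k ≤ m →
    f n m = MvPolynomial.eval ![(n : ℚ), (m : ℚ)] p

theorem EventuallyPoly.congr {f g : ℕ → ℕ → ℚ} (hf : EventuallyPoly f) {k : ℕ}
    (h : ∀ n m, k ≤ n → k ≤ m → g n m = f n m) : EventuallyPoly g := by
  obtain ⟨p, l, hp⟩ := hf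
  refine ⟨p, max k l, fun n m hn hm => ?_⟩
  rw [h n m (by omega) (by omega), hp n m (by omega) (by omega)]

theorem EventuallyPoly.zero : EventuallyPoly fun _ _ => 0 :=
  ⟨0, 0, fun _ _ _ _ => by simp⟩

theorem EventuallyPoly.add {f g : ℕ → ℕ → ℚ} (hf : EventuallyPoly f) (hg : EventuallyPoly g) :
    EventuallyPoly fun n m => f n m + g n m := by
  obtain ⟨p, k, hp⟩ := hf
  obtain ⟨q, l, hq⟩ := hg
  exact ⟨p + q, max k l, fun n m hn hm => by
    beta_reduce
    rw [hp n m (by omega) (by omega), hq n m (by omega) (by omega), map_add]⟩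

theorem EventuallyPoly.sub {f g : ℕ → ℕ → ℚ} (hf : EventuallyPoly f) (hg : EventuallyPoly g) :
    EventuallyPoly fun n m => f n m - g n m := by
  obtain ⟨p, k, hp⟩ := hf
  obtain ⟨q, l, hq⟩ := hg
  exact ⟨p - q, max k l, fun n m hn hm => by
    beta_reduce
    rw [hp n m (by omega) (by omega), hq n m (by omega) (by omega), map_sub]⟩

/-- Polynomial substitution. -/
theorem eval_bind₁_pair (p : MvPolynomial (Fin 2) ℚ) (q₀ q₁ : MvPolynomial (Fin 2) ℚ)
    (v : Fin 2 → ℚ) : MvPolynomial.eval v (MvPolynomial.bind₁ ![q₀, q₁] p) =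
      MvPolynomial.eval ![MvPolynomial.eval v q₀, MvPolynomial.eval v q₁] p := by
  rw [MvPolynomial.eval, MvPolynomial.eval₂Hom_bind₁]
  congr 2
  funext j
  fin_cases j <;> rfl

theorem EventuallyPoly.shift {f : ℕ → ℕ → ℚ} (hf : EventuallyPoly f) :
    EventuallyPoly fun n m => f (n + 1) m := by
  obtain ⟨p, k, hp⟩ := hf
  refine ⟨MvPolynomial.bind₁ ![MvPolynomial.X 0 + 1, MvPolynomial.X 1] p, k, fun n m hn hm => ?_⟩
  beta_reduce
  rw [hp _ _ (by omega) hm, eval_bind₁_pair]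
  simp

theorem EventuallyPoly.swap {f : ℕ → ℕ → ℚ} (hf : EventuallyPoly f) :
    EventuallyPoly fun n m => f m n := by
  obtain ⟨p, k, hp⟩ := hf
  refine ⟨MvPolynomial.bind₁ ![MvPolynomial.X 1, MvPolynomial.X 0] p, k, fun n m hn hm => ?_⟩
  beta_reduce
  rw [hp _ _ hm hn, eval_bind₁_pair]
  simp

theorem exists_polynomial_antidifference (p : MvPolynomial (Fin 2) ℚ) :
    ∃ P : MvPolynomial (Fin 2) ℚ, ∀ n m : ℚ,
      MvPolynomial.eval ![n + 1, m] P - MvPolynomial.eval ![n, m] P =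
        MvPolynomial.eval ![n, m] p := by
  induction p using MvPolynomial.induction_on' with
  | add p q hp hq =>
    obtain ⟨P, hP⟩ := hp
    obtain ⟨Q, hQ⟩ := hq
    exact ⟨P + Q, fun n m => by rw [map_add, map_add, map_add, ← hP, ← hQ]; ring⟩
  | monomial e c =>
    -- The Bernoulli polynomials satisfy `B_(d+1)(n + 1) - B_(d+1)(n) = (d + 1) n^d`.
    refine ⟨MvPolynomial.C (c / (e 0 + 1)) * MvPolynomial.X 1 ^ e 1 *
      Polynomial.aeval (MvPolynomial.X 0) (Polynomial.bernoulli (e 0 + 1)), fun n m => ?_⟩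
    have h (v : Fin 2 → ℚ) : MvPolynomial.eval v (Polynomial.aeval
        (MvPolynomial.X 0 : MvPolynomial (Fin 2) ℚ) (Polynomial.bernoulli (e 0 + 1))) =
        (Polynomial.bernoulli (e 0 + 1)).eval (v 0) := by
      rw [← MvPolynomial.coe_aeval_eq_eval, RingHom.coe_coe, ← Polynomial.aeval_algHom_apply]
      simp
    have hb := Polynomial.bernoulli_eval_one_add (e 0 + 1) n
    simp only [map_mul, map_pow, MvPolynomial.eval_C, MvPolynomial.eval_X, h,
      MvPolynomial.eval_monomial]
    rw [Finsupp.prod_fintype _ _ (by simp), Fin.prod_univ_two]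
    simp only [Matrix.cons_val_zero, Matrix.cons_val_one]
    rw [add_comm n 1, hb]
    push_cast
    have : (e 0 : ℚ) + 1 ≠ 0 := by positivity
    field_simp
    ring

/-- Telescope from `(k, k)` to `(k, m)` and then to `(n, m)`. The second difference is needed only
on the line where the first index is `k`. -/
theorem EventuallyPoly.of_differences {f : ℕ → ℕ → ℚ}
    (hx : EventuallyPoly fun n m => f (n + 1) m - f n m)
    (hy : EventuallyPoly fun n m => f n (m + 1) - f n m) : EventuallyPoly f := by
  obtain ⟨p, k₁, hp⟩ := hx
  obtain ⟨q, k₂, hq⟩ := hy.swap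
  obtain ⟨P, hP⟩ := exists_polynomial_antidifference p
  obtain ⟨Q, hQ⟩ := exists_polynomial_antidifference q
  let k := max k₁ k₂
  have h1 (n m : ℕ) (hn : k ≤ n) (hm : k ≤ m) : f n m =
      f k m + MvPolynomial.eval ![(n : ℚ), (m : ℚ)] P - MvPolynomial.eval ![(k : ℚ), (m : ℚ)] P := by
    induction n, hn using Nat.le_induction with
    | base => ring
    | succ n hn ih =>
      have h2 := hp n m (by omega) (by omega)
      rw [← hP] at h2
      push_cast
      linarith
  have h3 (m : ℕ) (hm : k ≤ m) : f k m =
      f k k + MvPolynomial.eval ![(m : ℚ), (k : ℚ)] Q - MvPolynomial.eval ![(k : ℚ), (k : ℚ)] Q := by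
    induction m, hm using Nat.le_induction with
    | base => ring
    | succ m hm ih =>
      have h2 := hq m k (by omega) (by omega)
      rw [← hQ] at h2
      push_cast
      linarith
  refine ⟨MvPolynomial.C (f k k - MvPolynomial.eval ![(k : ℚ), (k : ℚ)] Q) +
    MvPolynomial.bind₁ ![MvPolynomial.X 1, MvPolynomial.C (k : ℚ)] Q + P -
    MvPolynomial.bind₁ ![MvPolynomial.C (k : ℚ), MvPolynomial.X 1] P, k, fun n m hn hm => ?_⟩
  rw [h1 n m hn hm, h3 m hm, map_sub, map_add, map_add, eval_bind₁_pair, eval_bind₁_pair]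
  simp
  ring

end EventuallyPolynomialFunctions

/-! ### Hilbert-Serre induction for Noetherian bigraded families. -/

section HilbertFunction

variable {R : Type u} [CommRing R] {σ τ : Type} {E : ℕ → ℕ → Type u}
  [∀ n m, AddCommGroup (E n m)] [∀ n m, Module R (E n m)]
  {x : σ → ∀ n m, E n m →ₗ[R] E (n + 1) m} {y : τ → ∀ n m, E n m →ₗ[R] E n (m + 1)}

theorem StableFamily.swap {U : ∀ n m, Submodule R (E n m)} (h : StableFamily x y U) :
    StableFamily (E := fun m n => E n m) (fun j m n => y j n m) (fun j m n => x j n m)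
      (fun m n => U n m) :=
  ⟨fun j m n => h.2 j n m, fun j m n => h.1 j n m⟩

theorem FamilyNoetherian.swap (h : FamilyNoetherian x y) :
    FamilyNoetherian (E := fun m n => E n m) (fun j m n => y j n m) (fun j m n => x j n m) := by
  intro U hU hs
  obtain ⟨k, hk⟩ := h (fun l n m => U l m n) (fun l l' hl n m => hU hl m n)
    (fun l => (hs l).swap)
  refine ⟨k, fun l hl => ?_⟩
  funext m n
  exact congrFun (congrFun (hk l hl) n) m

/-- Nested stable families such that only the operators indexed by `S` and `S'` may act nontrivially
on the quotient. -/
structure HilbertPair (x : σ → ∀ n m, E n m →ₗ[R] E (n + 1) m)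
    (y : τ → ∀ n m, E n m →ₗ[R] E n (m + 1)) (S : Finset σ) (S' : Finset τ)
    (C D : ∀ n m, Submodule R (E n m)) : Prop where
  stable_left : StableFamily x y C
  stable_right : StableFamily x y D
  le : ∀ n m, D n m ≤ C n m
  left_trivial : ∀ j ∉ S, ∀ n m, C n m ≤ (D (n + 1) m).comap (x j n m)
  right_trivial : ∀ j ∉ S', ∀ n m, C n m ≤ (D n (m + 1)).comap (y j n m)

theorem HilbertPair.swap {S : Finset σ} {S' : Finset τ} {C D : ∀ n m, Submodule R (E n m)}
    (h : HilbertPair x y S S' C D) :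
    HilbertPair (E := fun m n => E n m) (fun j m n => y j n m) (fun j m n => x j n m) S' S
      (fun m n => C n m) (fun m n => D n m) :=
  ⟨h.1.swap, h.2.swap, fun m n => h.3 n m, fun j hj m n => h.5 j hj n m,
    fun j hj m n => h.4 j hj n m⟩

/-- All `x`-operators kill `C/D`, so the family equal to `C` in `n`-degrees at most `l` and to `D`
beyond is stable. It increases with `l`, and its stabilization forces `C = D` in large `n`-degree.
-/
theorem HilbertPair.eventually_eq (hN : FamilyNoetherian x y) {S' : Finset τ}
    {C D : ∀ n m, Submodule R (E n m)} (h : HilbertPair x y ∅ S' C D) :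
    ∃ k, ∀ n ≥ k, ∀ m, C n m = D n m := by
  obtain ⟨k, hk⟩ := hN (fun l n m => if n ≤ l then C n m else D n m)
    (fun l l' hl n m => by
      dsimp only
      split_ifs with h1 h2
      · exact le_rfl
      · omega
      · exact h.le n m
      · exact le_rfl)
    (fun l => ⟨fun j n m => by
      dsimp only
      have h1 := h.left_trivial j (Finset.notMem_empty j) n m
      have h2 := Submodule.comap_mono (f := x j n m) (h.le (n + 1) m)
      split_ifs
      · exact h1.trans h2
      · exact h1
      · omega
      · exact h.stable_right.1 j n m, fun j n m => by
      dsimp only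
      split_ifs
      · exact h.stable_left.2 j n m
      · exact h.stable_right.2 j n m⟩)
  refine ⟨k + 1, fun n hn m => ?_⟩
  -- In `n`-degree `n > k`, stage `n` of the chain is `C` and stage `k` is `D`.
  have := congrFun (congrFun (hk n (by omega)) n) m
  simpa [show ¬ n ≤ k by omega] using this

/-- The length of a submodule as a rational number. -/
noncomputable def ratLength {X : Type u} [AddCommGroup X] [Module R X] (U : Submodule R X) : ℚ :=
  ((Module.length R U).toNat : ℚ)

/-- Lengths add along `0 → C ⊓ f⁻¹D → D × C → D ⊔ f(C) → 0`, with first map `z ↦ (-f z, z)`. -/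
theorem ratLength_sup_map {X Y : Type u} [AddCommGroup X] [Module R X] [AddCommGroup Y] [Module R Y]
    (hX : Module.length R X ≠ ⊤) (hY : Module.length R Y ≠ ⊤) (f : X →ₗ[R] Y) (C : Submodule R X)
    (D : Submodule R Y) :
    ratLength (D ⊔ C.map f) + ratLength (C ⊓ D.comap f) = ratLength D + ratLength C := by
  have hfin {Z : Type u} [AddCommGroup Z] [Module R Z] (hZ : Module.length R Z ≠ ⊤)
      (U : Submodule R Z) : Module.length R U ≠ ⊤ :=
    ne_top_of_le_ne_top hZ (Module.length_le_of_injective U.subtype (Submodule.subtype_injective _))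
  let g : D × C →ₗ[R] ↥(D ⊔ C.map f) :=
    (D.subtype.coprod (f ∘ₗ C.subtype)).codRestrict _ fun z =>
      Submodule.add_mem_sup z.1.2 (Submodule.mem_map_of_mem z.2.2)
  let k : ↥(C ⊓ D.comap f) →ₗ[R] D × C :=
    ((-(f ∘ₗ (C ⊓ D.comap f).subtype)).codRestrict D fun z => D.neg_mem z.2.2).prod
      (Submodule.inclusion inf_le_left)
  have hk : Function.Injective k := fun z w h =>
    Subtype.ext (congrArg (fun t : D × C => (t.2 : X)) h)
  have hg : Function.Surjective g := by
    rintro ⟨z, hz⟩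
    obtain ⟨d, hd, _, ⟨c, hc, rfl⟩, rfl⟩ := Submodule.mem_sup.1 hz
    exact ⟨(⟨d, hd⟩, ⟨c, hc⟩), rfl⟩
  have hex : Function.Exact k g := by
    rintro ⟨⟨d, hd⟩, ⟨c, hc⟩⟩
    constructor
    · intro h
      have h' : d + f c = 0 := congrArg Subtype.val h
      have h2 : f c = -d := (neg_eq_of_add_eq_zero_right h').symm
      refine ⟨⟨c, hc, ?_⟩, ?_⟩
      · change f c ∈ D
        rw [h2]
        exact D.neg_mem hd
      · refine Prod.ext (Subtype.ext ?_) rfl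
        change -f c = d
        rw [h2, neg_neg]
    · rintro ⟨z, hz⟩
      rw [← hz]
      refine Subtype.ext ?_
      change -f z + f z = 0
      exact neg_add_cancel _
  have h := Module.length_eq_add_of_exact k g hk hg hex
  rw [Module.length_prod] at h
  unfold ratLength
  rw [← Nat.cast_add, ← Nat.cast_add, ← ENat.toNat_add (hfin hY _) (hfin hX _),
    ← ENat.toNat_add (hfin hY _) (hfin hX _), h, add_comm]

/-- The family generated in the next degree by a stable family. -/
def nextFamily (f : ∀ n m, E n m →ₗ[R] E (n + 1) m) (C D : ∀ n m, Submodule R (E n m)) :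
    ∀ n m, Submodule R (E n m)
  | 0, m => D 0 m
  | n + 1, m => D (n + 1) m ⊔ (C n m).map (f n m)

theorem le_nextFamily (f : ∀ n m, E n m →ₗ[R] E (n + 1) m) (C D : ∀ n m, Submodule R (E n m))
    (n m : ℕ) : D n m ≤ nextFamily f C D n m := by
  cases n with
  | zero => exact le_rfl
  | succ n => exact le_sup_left

/-- The operators commute with each other. -/
structure CommutingOperators (x : σ → ∀ n m, E n m →ₗ[R] E (n + 1) m)
    (y : τ → ∀ n m, E n m →ₗ[R] E n (m + 1)) : Prop where
  left : ∀ i j n m e, x i (n + 1) m (x j n m e) = x j (n + 1) m (x i n m e)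
  right : ∀ i j n m e, y i n (m + 1) (y j n m e) = y j n (m + 1) (y i n m e)
  mixed : ∀ i j n m e, x i n (m + 1) (y j n m e) = y j (n + 1) m (x i n m e)

theorem CommutingOperators.swap (h : CommutingOperators x y) :
    CommutingOperators (E := fun m n => E n m) (fun j m n => y j n m) (fun j m n => x j n m) :=
  ⟨fun i j m n => h.right i j n m, fun i j m n => h.left i j n m,
    fun i j m n e => (h.mixed j i n m e).symm⟩

theorem stableFamily_nextFamily (hc : CommutingOperators x y) {C D : ∀ n m, Submodule R (E n m)}
    (hC : StableFamily x y C) (hD : StableFamily x y D) (j : σ) :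
    StableFamily x y (nextFamily (x j) C D) := by
  constructor
  · intro i n m
    cases n with
    | zero => exact (hD.1 i 0 m).trans (Submodule.comap_mono le_sup_left)
    | succ n =>
      refine sup_le ((hD.1 i (n + 1) m).trans (Submodule.comap_mono le_sup_left)) ?_
      rintro _ ⟨c, hc', rfl⟩
      exact Submodule.mem_sup_right ⟨x i n m c, hC.1 i n m hc', hc.left j i n m c⟩
  · intro i n m
    cases n with
    | zero => exact hD.2 i 0 m
    | succ n =>
      refine sup_le ((hD.2 i (n + 1) m).trans (Submodule.comap_mono le_sup_left)) ?_
      rintro _ ⟨c, hc', rfl⟩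
      exact Submodule.mem_sup_right ⟨y i n m c, hC.2 i n m hc', hc.mixed j i n m c⟩

/-- The new pair represents the cokernel of `x j` on `C/D`, on which `x j` acts as zero, so `j`
leaves `S`. -/
theorem HilbertPair.coker [DecidableEq σ] (hc : CommutingOperators x y) {S : Finset σ}
    {S' : Finset τ} {C D : ∀ n m, Submodule R (E n m)} (h : HilbertPair x y S S' C D) (j : σ) :
    HilbertPair x y (S.erase j) S' C (nextFamily (x j) C D) where
  stable_left := h.stable_left
  stable_right := stableFamily_nextFamily hc h.stable_left h.stable_right j
  le n m := by
    cases n with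
    | zero => exact h.le 0 m
    | succ n => exact sup_le (h.le (n + 1) m) (Submodule.map_le_iff_le_comap.2
        (h.stable_left.1 j n m))
  left_trivial i hi n m := by
    by_cases hij : i = j
    · subst hij
      exact fun c hc' => Submodule.mem_sup_right ⟨c, hc', rfl⟩
    · exact (h.left_trivial i (fun hi' => hi (Finset.mem_erase.2 ⟨hij, hi'⟩)) n m).trans
        (Submodule.comap_mono (le_nextFamily _ _ _ _ _))
  right_trivial i hi n m :=
    (h.right_trivial i hi n m).trans (Submodule.comap_mono (le_nextFamily _ _ _ _ _))

/-- The new pair represents the kernel of `x j` on `C/D`, again killed by `x j`. -/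
theorem HilbertPair.ker [DecidableEq σ] (hc : CommutingOperators x y) {S : Finset σ}
    {S' : Finset τ} {C D : ∀ n m, Submodule R (E n m)} (h : HilbertPair x y S S' C D) (j : σ) :
    HilbertPair x y (S.erase j) S' (fun n m => C n m ⊓ (D (n + 1) m).comap (x j n m)) D where
  stable_left := by
    constructor
    · intro i n m c hc'
      refine ⟨h.stable_left.1 i n m hc'.1, ?_⟩
      change x j (n + 1) m (x i n m c) ∈ D (n + 2) m
      rw [hc.left]
      exact h.stable_right.1 i (n + 1) m hc'.2
    · intro i n m c hc'
      refine ⟨h.stable_left.2 i n m hc'.1, ?_⟩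
      change x j n (m + 1) (y i n m c) ∈ D (n + 1) (m + 1)
      rw [hc.mixed]
      exact h.stable_right.2 i (n + 1) m hc'.2
  stable_right := h.stable_right
  le n m := le_inf (h.le n m) (h.stable_right.1 j n m)
  left_trivial i hi n m := by
    by_cases hij : i = j
    · subst hij
      exact inf_le_right
    · exact inf_le_left.trans
        (h.left_trivial i (fun hi' => hi (Finset.mem_erase.2 ⟨hij, hi'⟩)) n m)
  right_trivial i hi n m := inf_le_left.trans (h.right_trivial i hi n m)

/-- The difference of the Hilbert function of `C/D` is the cokernel length in degree `n + 1` minus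
the kernel length in degree `n`. -/
theorem HilbertPair.difference [DecidableEq σ] (hc : CommutingOperators x y)
    (hfin : ∀ n m, Module.length R (E n m) ≠ ⊤) {S : Finset σ}
    {S' : Finset τ} {C D : ∀ n m, Submodule R (E n m)} (h : HilbertPair x y S S' C D) (j : σ)
    (ih : ∀ C D, HilbertPair x y (S.erase j) S' C D →
      EventuallyPoly fun n m => ratLength (C n m) - ratLength (D n m)) :
    EventuallyPoly fun n m => (ratLength (C (n + 1) m) - ratLength (D (n + 1) m)) -
      (ratLength (C n m) - ratLength (D n m)) := by
  refine ((ih _ _ (h.coker hc j)).shift.sub (ih _ _ (h.ker hc j))).congr (k := 0)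
    fun n m _ _ => ?_
  have := ratLength_sup_map (hfin n m) (hfin (n + 1) m) (x j n m) (C n m) (D (n + 1) m)
  change _ = (ratLength (C (n + 1) m) - ratLength (D (n + 1) m ⊔ (C n m).map (x j n m))) - _
  linarith

/-- The Hilbert function of a noetherian family is eventually polynomial. -/
theorem HilbertPair.eventuallyPoly (hN : FamilyNoetherian x y) (hc : CommutingOperators x y)
    (hfin : ∀ n m, Module.length R (E n m) ≠ ⊤) (d : ℕ) (S : Finset σ) (S' : Finset τ)
    (hd : S.card + S'.card = d) {C D : ∀ n m, Submodule R (E n m)}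
    (h : HilbertPair x y S S' C D) :
    EventuallyPoly fun n m => ratLength (C n m) - ratLength (D n m) := by
  classical
  induction d generalizing S S' C D with
  | zero =>
    obtain rfl : S = ∅ := Finset.card_eq_zero.1 (by omega)
    obtain ⟨k, hk⟩ := h.eventually_eq hN
    exact EventuallyPoly.zero.congr fun n m hn _ => by rw [hk n hn m, sub_self]
  | succ d ih =>
    rcases S.eq_empty_or_nonempty with rfl | ⟨j, hj⟩
    · obtain ⟨k, hk⟩ := h.eventually_eq hN
      exact EventuallyPoly.zero.congr fun n m hn _ => by rw [hk n hn m, sub_self]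
    rcases S'.eq_empty_or_nonempty with rfl | ⟨j', hj'⟩
    · obtain ⟨k, hk⟩ := h.swap.eventually_eq hN.swap
      exact EventuallyPoly.zero.congr fun n m _ hm => by rw [hk m hm n, sub_self]
    -- Both index sets are nonempty here, so an operator can be removed in each direction.
    refine EventuallyPoly.of_differences ?_ ?_
    · refine h.difference hc hfin j fun C D h' => ih _ _ ?_ h'
      rw [Finset.card_erase_of_mem hj]
      have := Finset.card_pos.2 ⟨j, hj⟩
      omega
    · refine (h.swap.difference hc.swap (fun m n => hfin n m) j' fun C D h' =>
        (ih S (S'.erase j') ?_ h'.swap).swap).swap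
      rw [Finset.card_erase_of_mem hj']
      have := Finset.card_pos.2 ⟨j', hj'⟩
      omega

theorem FamilyNoetherian.eventuallyPoly [Fintype σ] [Fintype τ] (hN : FamilyNoetherian x y)
    (hc : CommutingOperators x y) (hfin : ∀ n m, Module.length R (E n m) ≠ ⊤) :
    EventuallyPoly fun n m => ((Module.length R (E n m)).toNat : ℚ) := by
  have h : HilbertPair x y Finset.univ Finset.univ (fun n m => (⊤ : Submodule R (E n m)))
      (fun n m => ⊥) :=
    ⟨⟨fun _ _ _ _ _ => trivial, fun _ _ _ _ _ => trivial⟩, ⟨fun _ _ _ => bot_le,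
      fun _ _ _ => bot_le⟩, fun _ _ => bot_le, fun j hj => absurd (Finset.mem_univ j) hj,
      fun j hj => absurd (Finset.mem_univ j) hj⟩
  refine (h.eventuallyPoly hN hc hfin _ _ _ rfl).congr (k := 0) fun n m _ _ => ?_
  simp [ratLength]

/-- A noetherian family is generated in bounded degree. -/
theorem FamilyNoetherian.exists_generated [Fintype τ] (hN : FamilyNoetherian x y)
    (hc : CommutingOperators x y) :
    ∃ k, ∀ n ≥ k, ∀ m, (⨆ j, LinearMap.range (x j n m)) = ⊤ := by
  -- All `x`-operators kill the quotient of the whole family by their images, so that quotient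
  -- vanishes in large `n`-degree, for every `m` at once.
  let D : ∀ n m, Submodule R (E n m)
    | 0, _ => ⊥
    | n + 1, m => ⨆ j, LinearMap.range (x j n m)
  have hx (j n m) : (⊤ : Submodule R (E n m)) ≤ (D (n + 1) m).comap (x j n m) := fun e _ =>
    Submodule.mem_iSup_of_mem j (LinearMap.mem_range_self _ e)
  have h : HilbertPair x y ∅ Finset.univ (fun n m => (⊤ : Submodule R (E n m))) D := by
    refine ⟨⟨fun _ _ _ _ _ => trivial, fun _ _ _ _ _ => trivial⟩,
      ⟨fun j n m => le_top.trans (hx j n m), fun i n m => ?_⟩, fun _ _ => le_top,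
      fun j _ n m => hx j n m, fun j hj => absurd (Finset.mem_univ j) hj⟩
    cases n with
    | zero => exact bot_le
    | succ n =>
      refine iSup_le fun j => ?_
      rintro _ ⟨e, rfl⟩
      exact Submodule.mem_iSup_of_mem j ⟨y i n m e, hc.mixed j i n m e⟩
  obtain ⟨k, hk⟩ := h.eventually_eq hN
  exact ⟨k, fun n hn m => (hk (n + 1) (by omega) m).symm⟩

end HilbertFunction

/-! ### Finite length of the tensor product and the annihilators of its factors. -/

section FiniteLength

variable {R : Type u} [CommRing R]

/-- Base change to the residue field at `p` gives a tensor product of two nonzero vector spaces. -/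
theorem mem_support_tensorProduct {M N : Type u} [AddCommGroup M] [Module R M] [Module.Finite R M]
    [AddCommGroup N] [Module R N] [Module.Finite R N] {p : PrimeSpectrum R}
    (hM : p ∈ Module.support R M) (hN : p ∈ Module.support R N) :
    p ∈ Module.support R (M ⊗[R] N) := by
  rw [Module.mem_support_iff_nontrivial_residueField_tensorProduct] at hM hN ⊢
  rw [(TensorProduct.AlgebraTensorModule.distribBaseChange R p.asIdeal.ResidueField M
    N).toEquiv.nontrivial_congr]
  exact (Module.FaithfullyFlat.nontrivial_tensorProduct_iff_left _ _).2 hM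

variable [IsLocalRing R]

open IsLocalRing in
-- The chain `P^n T` stabilizes since `T` is Artinian, and its stable value is zero by Nakayama.
theorem exists_maximalIdeal_pow_le_annihilator {T : Type u} [AddCommGroup T] [Module R T]
    (hT : IsFiniteLength R T) : ∃ c, maximalIdeal R ^ c ≤ Module.annihilator R T := by
  obtain ⟨_, _⟩ := isFiniteLength_iff_isNoetherian_isArtinian.1 hT
  obtain ⟨c, hc⟩ := IsArtinian.monotone_stabilizes (R := R) (M := T)
    ⟨fun n => OrderDual.toDual (maximalIdeal R ^ n • (⊤ : Submodule R T)),
      fun m n h => Submodule.smul_mono_left (Ideal.pow_le_pow_right h)⟩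
  refine ⟨c, ?_⟩
  have h1 : maximalIdeal R ^ c • (⊤ : Submodule R T) =
      maximalIdeal R • (maximalIdeal R ^ c • (⊤ : Submodule R T)) := by
    rw [← Submodule.mul_smul, ← pow_succ']
    exact hc (c + 1) (by omega)
  have h2 : maximalIdeal R ^ c • (⊤ : Submodule R T) = ⊥ :=
    Submodule.eq_bot_of_le_smul_of_le_jacobson_bot (maximalIdeal R) _ (IsNoetherian.noetherian _)
      h1.le (maximalIdeal_le_jacobson _)
  rw [← Submodule.annihilator_top, Submodule.le_annihilator_iff]
  exact h2

variable [IsNoetherianRing R]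

open IsLocalRing in
theorem exists_maximalIdeal_pow_le_sup_annihilator {M N : Type u} [AddCommGroup M] [Module R M]
    [Module.Finite R M] [AddCommGroup N] [Module R N] [Module.Finite R N]
    (h : IsFiniteLength R (M ⊗[R] N)) :
    ∃ e, maximalIdeal R ^ e ≤ Module.annihilator R M ⊔ Module.annihilator R N := by
  obtain ⟨c, hc⟩ := exists_maximalIdeal_pow_le_annihilator h
  have hrad : maximalIdeal R ≤ (Module.annihilator R M ⊔ Module.annihilator R N).radical := by
    rw [Ideal.radical_eq_sInf]
    refine le_sInf ?_
    rintro p ⟨hp, hprime⟩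
    let P : PrimeSpectrum R := ⟨p, hprime⟩
    have hP : P ∈ Module.support R (M ⊗[R] N) := mem_support_tensorProduct
      (Module.mem_support_iff_of_finite.2 (le_sup_left.trans hp))
      (Module.mem_support_iff_of_finite.2 (le_sup_right.trans hp))
    exact hprime.le_of_pow_le (hc.trans (Module.annihilator_le_of_mem_support hP))
  obtain ⟨n, hn⟩ := Ideal.exists_radical_pow_le_of_fg
    (Module.annihilator R M ⊔ Module.annihilator R N) (IsNoetherian.noetherian _)
  exact ⟨n, (Ideal.pow_right_mono hrad n).trans hn⟩

open IsLocalRing in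
theorem length_ne_top_of_maximalIdeal_pow_le {T : Type u} [AddCommGroup T] [Module R T]
    [Module.Finite R T] {e : ℕ} (h : maximalIdeal R ^ e ≤ Module.annihilator R T) :
    Module.length R T ≠ ⊤ := by
  -- The exponent `e + 1` keeps `R ⧸ Q` nonzero even if `e = 0`; `T` is then finite over an Artinian
  -- ring.
  let Q := maximalIdeal R ^ (e + 1)
  have hQ : Q ≤ maximalIdeal R := Ideal.pow_le_self e.succ_ne_zero
  have : Nontrivial (R ⧸ Q) :=
    Ideal.Quotient.nontrivial_iff.2 fun h => (maximalIdeal.isMaximal R).ne_top (top_le_iff.1 (h ▸ hQ))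
  have : IsLocalRing (R ⧸ Q) := IsLocalRing.of_surjective' _ Ideal.Quotient.mk_surjective
  have : IsArtinianRing (R ⧸ Q) := by
    rw [isArtinianRing_iff_isNilpotent_maximalIdeal]
    refine ⟨e + 1, ?_⟩
    have h1 : maximalIdeal (R ⧸ Q) ≤ (maximalIdeal R).map (Ideal.Quotient.mk Q) := by
      rw [← Ideal.map_comap_of_surjective _ Ideal.Quotient.mk_surjective (maximalIdeal (R ⧸ Q))]
      exact Ideal.map_mono (le_maximalIdeal (Ideal.comap_ne_top _ (maximalIdeal.isMaximal _).ne_top))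
    refine le_bot_iff.1 ((Ideal.pow_right_mono h1 _).trans ?_)
    rw [← Ideal.map_pow, Ideal.map_quotient_self]
  have htors : Module.IsTorsionBySet R T Q := by
    rw [Module.isTorsionBySet_iff_subset_annihilator]
    exact (Ideal.pow_le_pow_right e.le_succ).trans h
  let _ := htors.module
  have : IsScalarTower R (R ⧸ Q) T := htors.isScalarTower
  have : Module.Finite (R ⧸ Q) T := Module.Finite.of_restrictScalars_finite R _ _
  rw [Module.length_eq_of_surjective (R := R ⧸ Q) (S := R) Ideal.Quotient.mk_surjective]
  exact Module.length_ne_top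

end FiniteLength

/-! ### Annihilators, vanishing of inclusion maps, and Hilbert functions for the Tor family. -/

section TorLengths

variable {R : Type u} [CommRing R]

/-- Multiplication by a scalar on Tor is induced by that multiplication on either argument, where it
may be zero. -/
theorem torMod_smul_eq_zero {X Y : Type u} [AddCommGroup X] [Module R X] [AddCommGroup Y]
    [Module R Y] (i : ℕ) {c : R} (hc : c ∈ Module.annihilator R X ⊔ Module.annihilator R Y)
    (t : TorMod R i X Y) : c • t = 0 := by
  obtain ⟨a, ha, b, hb, rfl⟩ := Submodule.mem_sup.1 hc
  rw [Module.mem_annihilator] at ha hb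
  rw [add_smul, ← torMap_smul_id_left i a t, ← torMap_smul_id_right i b t,
    show a • (LinearMap.id : X →ₗ[R] X) = 0 from LinearMap.ext ha,
    show b • (LinearMap.id : Y →ₗ[R] Y) = 0 from LinearMap.ext hb, torMap_zero_left,
    torMap_zero_right, add_zero]

theorem le_annihilator_torMod {M N X Y : Type u} [AddCommGroup M] [Module R M] [AddCommGroup N]
    [Module R N] [AddCommGroup X] [Module R X] [AddCommGroup Y] [Module R Y] {Q : Ideal R}
    (hQ : Q ≤ Module.annihilator R M ⊔ Module.annihilator R N) {f : X →ₗ[R] M}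
    (hf : Function.Injective f) {g : Y →ₗ[R] N} (hg : Function.Injective g) (i : ℕ) :
    Q ≤ Module.annihilator R (TorMod R i X Y) := by
  intro c hc
  rw [Module.mem_annihilator]
  intro t
  exact torMod_smul_eq_zero i (sup_le_sup (LinearMap.annihilator_le_of_injective f hf)
    (LinearMap.annihilator_le_of_injective g hg) (hQ hc)) t

/-- If each step of a family acquires a factor in `I`, the images decrease along powers of `I`. -/
theorem range_le_pow_smul {σ : Type} {T : ℕ → Type u} [∀ n, AddCommGroup (T n)]
    [∀ n, Module R (T n)] {Z : Type u} [AddCommGroup Z] [Module R Z] {I : Ideal R} {a : σ → I}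
    (x : σ → ∀ n, T n →ₗ[R] T (n + 1)) (hx : ∀ n, (⨆ j, LinearMap.range (x j n)) = ⊤)
    (g : ∀ n, T n →ₗ[R] Z) (hg : ∀ j n t, g (n + 1) (x j n t) = (a j : R) • g n t) (n : ℕ) :
    LinearMap.range (g n) ≤ I ^ n • (⊤ : Submodule R Z) := by
  induction n with
  | zero => rw [pow_zero, Ideal.one_eq_top, Submodule.top_smul]; exact le_top
  | succ n ih =>
    rw [LinearMap.range_eq_map, ← hx n, Submodule.map_iSup]
    refine iSup_le fun j => ?_
    rintro _ ⟨_, ⟨t, rfl⟩, rfl⟩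
    rw [hg, pow_succ', Submodule.mul_smul]
    exact Submodule.smul_mem_smul (a j).2 (ih (LinearMap.mem_range_self _ t))

variable {I J : Ideal R} {r s : ℕ} {a : Fin r → I} {b : Fin s → J} (M N : Type u)
  [AddCommGroup M] [Module R M] [AddCommGroup N] [Module R N]

theorem reesMul_comm (c d : I) (n : ℕ) :
    reesMul M c (n + 1) ∘ₗ reesMul M d n = reesMul M d (n + 1) ∘ₗ reesMul M c n :=
  LinearMap.ext fun m => Subtype.ext (smul_comm (c : R) (d : R) (m : M))

theorem commutingOperators_tor (a : Fin r → I) (b : Fin s → J) (i : ℕ) : CommutingOperators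
    (E := fun n m => TorMod R i ↥(I ^ n • (⊤ : Submodule R M)) ↥(J ^ m • (⊤ : Submodule R N)))
    (fun j n _ => torMap i (reesMul M (a j) n) LinearMap.id)
    (fun j _ m => torMap i LinearMap.id (reesMul N (b j) m)) where
  left j j' n m t := by rw [torMap_torMap, torMap_torMap, reesMul_comm]
  right j j' n m t := by rw [torMap_torMap, torMap_torMap, reesMul_comm]
  mixed j j' n m t := by rw [torMap_torMap, torMap_torMap]; rfl

theorem exists_fin_generators [IsNoetherianRing R] (I : Ideal R) :
    ∃ (r : ℕ) (a : Fin r → I), Ideal.span (Set.range fun j => (a j : R)) = I := by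
  obtain ⟨r, a, ha⟩ := Submodule.fg_iff_exists_fin_generating_family.1
    (IsNoetherian.noetherian I)
  exact ⟨r, fun j => ⟨a j, ha ▸ Submodule.subset_span ⟨j, rfl⟩⟩, ha⟩

/-- The inclusion `I ^ (n + l) M → I ^ n M`. -/
abbrev reesIncl (I : Ideal R) (n l : ℕ) :
    ↥(I ^ (n + l) • (⊤ : Submodule R M)) →ₗ[R] ↥(I ^ n • (⊤ : Submodule R M)) :=
  Submodule.inclusion (Submodule.smul_mono_left (Ideal.pow_le_pow_right (n.le_add_right l)))

variable [Module.Finite R M] [Module.Finite R N] [IsNoetherianRing R]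

theorem exists_torMap_incl_eq_zero {e : ℕ}
    (hI : I ^ e ≤ Module.annihilator R M ⊔ Module.annihilator R N)
    (hJ : J ^ e ≤ Module.annihilator R M ⊔ Module.annihilator R N) (i : ℕ) :
    ∃ k, ∀ j ≤ i, ∀ n m,
      (k ≤ n → ∀ t : TorMod R j ↥(I ^ (n + e) • (⊤ : Submodule R M))
        ↥(J ^ m • (⊤ : Submodule R N)), torMap j (reesIncl M I n e) LinearMap.id t = 0) ∧
      (k ≤ m → ∀ t : TorMod R j ↥(I ^ n • (⊤ : Submodule R M))
        ↥(J ^ (m + e) • (⊤ : Submodule R N)), torMap j LinearMap.id (reesIncl N J m e) t = 0) := by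
  obtain ⟨r, a, ha⟩ := exists_fin_generators I
  obtain ⟨s, b, hb⟩ := exists_fin_generators J
  have key (j : ℕ) : ∃ k, ∀ n m,
      (k ≤ n → ∀ t : TorMod R j ↥(I ^ (n + e) • (⊤ : Submodule R M))
        ↥(J ^ m • (⊤ : Submodule R N)), torMap j (reesIncl M I n e) LinearMap.id t = 0) ∧
      (k ≤ m → ∀ t : TorMod R j ↥(I ^ n • (⊤ : Submodule R M))
        ↥(J ^ (m + e) • (⊤ : Submodule R N)),
          torMap j LinearMap.id (reesIncl N J m e) t = 0) := by
    have hN := familyNoetherian_tor M N ha hb j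
    have hc := commutingOperators_tor M N a b j
    obtain ⟨k₁, hk₁⟩ := hN.exists_generated hc
    obtain ⟨k₂, hk₂⟩ := hN.swap.exists_generated hc.swap
    refine ⟨max k₁ k₂, fun n m => ⟨fun hn t => ?_, fun hm t => ?_⟩⟩
    -- Beyond the generating degree, each of the `e` steps down from `n + e` to `n` contributes a
    -- factor in `I`, so the image lies in `I^e Tor_j = 0`.
    · have h := range_le_pow_smul (Z := TorMod R j ↥(I ^ n • (⊤ : Submodule R M))
        ↥(J ^ m • (⊤ : Submodule R N))) (a := a)
        (T := fun l => TorMod R j ↥(I ^ (n + l) • (⊤ : Submodule R M))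
          ↥(J ^ m • (⊤ : Submodule R N)))
        (fun i l => torMap j (reesMul M (a i) (n + l)) LinearMap.id)
        (fun l => hk₁ (n + l) (by omega) m)
        (fun l => torMap j (reesIncl M I n l) LinearMap.id)
        (fun i l t => by
          rw [torMap_torMap, ← torMap_smul_left]
          rfl) e
      have h0 := h (LinearMap.mem_range_self _ t)
      rwa [Submodule.le_annihilator_iff.1
        ((le_annihilator_torMod hI (Submodule.subtype_injective _)
          (Submodule.subtype_injective _) j).trans_eq Submodule.annihilator_top.symm)] at h0
    · have h := range_le_pow_smul (Z := TorMod R j ↥(I ^ n • (⊤ : Submodule R M))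
        ↥(J ^ m • (⊤ : Submodule R N))) (a := b)
        (T := fun l => TorMod R j ↥(I ^ n • (⊤ : Submodule R M))
          ↥(J ^ (m + l) • (⊤ : Submodule R N)))
        (fun i l => torMap j LinearMap.id (reesMul N (b i) (m + l)))
        (fun l => hk₂ (m + l) (by omega) n)
        (fun l => torMap j LinearMap.id (reesIncl N J m l))
        (fun i l t => by
          rw [torMap_torMap, ← torMap_smul_right]
          rfl) e
      have h0 := h (LinearMap.mem_range_self _ t)
      rwa [Submodule.le_annihilator_iff.1
        ((le_annihilator_torMod hJ (Submodule.subtype_injective _)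
          (Submodule.subtype_injective _) j).trans_eq Submodule.annihilator_top.symm)] at h0
  choose k hk using key
  refine ⟨(Finset.range (i + 1)).sup k, fun j hj n m => ?_⟩
  have := Finset.le_sup (f := k) (Finset.mem_range.2 (Nat.lt_succ_of_le hj))
  exact ⟨fun hn => (hk j n m).1 (this.trans hn), fun hm => (hk j n m).2 (this.trans hm)⟩

theorem torMod_length_eventuallyPoly {I J : Ideal R}
    (hfin : ∀ (i n m : ℕ), Module.length R (TorMod R i ↥(I ^ n • (⊤ : Submodule R M))
      ↥(J ^ m • (⊤ : Submodule R N))) ≠ ⊤) (i : ℤ) :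
    EventuallyPoly fun n m => ((torLength R i ↥(I ^ n • (⊤ : Submodule R M))
      ↥(J ^ m • (⊤ : Submodule R N))).toNat : ℚ) := by
  obtain ⟨r, a, ha⟩ := exists_fin_generators I
  obtain ⟨s, b, hb⟩ := exists_fin_generators J
  cases i with
  | negSucc i => exact EventuallyPoly.zero.congr (k := 0) fun n m _ _ => by simp [torLength]
  | ofNat i =>
    refine ((familyNoetherian_tor M N ha hb i).eventuallyPoly
      (commutingOperators_tor M N a b i) (hfin i)).congr (k := 0) fun n m _ _ => ?_
    rw [Int.ofNat_eq_natCast, torLength_natCast]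

end TorLengths

/-! ### Vanishing of the maps on Tor induced by the inclusions into `M` and `N`. -/

section Vanishing

variable {R : Type u} [CommRing R] [IsNoetherianRing R] {I J : Ideal R} (M N : Type u)
  [AddCommGroup M] [Module R M] [AddCommGroup N] [Module R N] [Module.Finite R M]
  [Module.Finite R N]

/-- A module as the zeroth step of its adic filtration. -/
abbrev powZeroEquiv (I : Ideal R) : M ≃ₗ[R] ↥(I ^ 0 • (⊤ : Submodule R M)) :=
  (LinearEquiv.ofTop _ (by rw [pow_zero, Ideal.one_eq_top, Submodule.top_smul])).symm

theorem exists_torMap_subtype_eq_zero {e : ℕ}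
    (hI : I ^ e ≤ Module.annihilator R M ⊔ Module.annihilator R N)
    (hJ : J ^ e ≤ Module.annihilator R M ⊔ Module.annihilator R N) (i : ℕ) :
    ∃ k, ∀ j ≤ i, ∀ n, k ≤ n → ∀ m, k ≤ m →
      (∀ t : TorMod R j ↥(I ^ n • (⊤ : Submodule R M)) N,
        torMap j (I ^ n • (⊤ : Submodule R M)).subtype LinearMap.id t = 0) ∧
      (∀ t : TorMod R j ↥(I ^ n • (⊤ : Submodule R M)) ↥(J ^ m • (⊤ : Submodule R N)),
        torMap j (I ^ n • (⊤ : Submodule R M)).subtype LinearMap.id t = 0) ∧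
      (∀ t : TorMod R j (M ⧸ (I ^ n • (⊤ : Submodule R M))) ↥(J ^ m • (⊤ : Submodule R N)),
        torMap j LinearMap.id (J ^ m • (⊤ : Submodule R N)).subtype t = 0) := by
  obtain ⟨k, hk⟩ := exists_torMap_incl_eq_zero M N hI hJ i
  have left (j : ℕ) (hj : j ≤ i) (n : ℕ) (hn : k + e ≤ n) (m : ℕ)
      (t : TorMod R j ↥(I ^ n • (⊤ : Submodule R M)) ↥(J ^ m • (⊤ : Submodule R N))) :
      torMap j (I ^ n • (⊤ : Submodule R M)).subtype LinearMap.id t = 0 := by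
    obtain ⟨l, hl, rfl⟩ : ∃ l, k ≤ l ∧ n = l + e := ⟨n - e, by omega, by omega⟩
    have h := congrArg (torMap j (I ^ l • (⊤ : Submodule R M)).subtype LinearMap.id)
      ((hk j hj l m).1 hl t)
    rw [torMap_torMap, map_zero] at h
    exact h
  have right (j : ℕ) (hj : j ≤ i) (m : ℕ) (hm : k + e ≤ m)
      (t : TorMod R j M ↥(J ^ m • (⊤ : Submodule R N))) :
      torMap j LinearMap.id (J ^ m • (⊤ : Submodule R N)).subtype t = 0 := by
    obtain ⟨l, hl, rfl⟩ : ∃ l, k ≤ l ∧ m = l + e := ⟨m - e, by omega, by omega⟩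
    -- The bound in `m` is uniform in `n`, so it applies at `n = 0`, where `I^0 M` is `M`.
    have h := congrArg (torMap j (powZeroEquiv M I).symm.toLinearMap
      (J ^ l • (⊤ : Submodule R N)).subtype) ((hk j hj 0 l).2 hl
        (torMap j (powZeroEquiv M I).toLinearMap LinearMap.id t))
    rw [torMap_torMap, torMap_torMap, map_zero] at h
    exact h
  refine ⟨k + e + e, fun j hj n hn m hm => ⟨fun t => ?_, left j hj n (by omega) m, fun t => ?_⟩⟩
  · have h := congrArg (torMap j LinearMap.id (powZeroEquiv N J).symm.toLinearMap)
      (left j hj n (by omega) 0 (torMap j LinearMap.id (powZeroEquiv N J).toLinearMap t))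
    rw [torMap_torMap, torMap_torMap, map_zero] at h
    exact h
  · obtain ⟨l, hl, rfl⟩ : ∃ l, k + e ≤ l ∧ m = l + e := ⟨m - e, by omega, by omega⟩
    have hex : Function.Exact (I ^ n • (⊤ : Submodule R M)).subtype
        (I ^ n • (⊤ : Submodule R M)).mkQ := LinearMap.exact_subtype_mkQ _
    have hinj : Function.Injective (I ^ n • (⊤ : Submodule R M)).subtype :=
      Submodule.subtype_injective _
    have hsurj : Function.Surjective (I ^ n • (⊤ : Submodule R M)).mkQ :=
      Submodule.mkQ_surjective _
    -- The first drop by `e` kills the connecting image in `Tor_(j-1)(I^nM, J^lN)`, so the class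
    -- lifts to `Tor_j(M, J^lN)`. Since `l ≥ k + e`, that lift dies in `Tor_j(M, N)`; hence the
    -- threshold `k + e + e`.
    obtain ⟨v, hv⟩ : ∃ v, torMap j (I ^ n • (⊤ : Submodule R M)).mkQ LinearMap.id v =
        torMap j LinearMap.id (reesIncl N J l e) t := by
      cases j with
      | zero => exact torMap_zero_surjective hsurj Function.surjective_id _
      | succ j =>
        refine (torMap_torδ_exact hex hinj hsurj j _).1 ?_
        rw [torδ_torMap_right]
        exact (hk j (by omega) n l).2 (by omega) _
    have h := congrArg (torMap j LinearMap.id (J ^ l • (⊤ : Submodule R N)).subtype) hv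
    rw [← torMap_left_right_comm, right j hj l hl, map_zero, torMap_torMap] at h
    exact h.symm

end Vanishing

theorem theorem9 (R : Type u) [CommRing R] [IsLocalRing R] [IsNoetherianRing R]
    (I J : Ideal R) (hI : I ≠ ⊤) (hJ : J ≠ ⊤)
    (M : Type u) [AddCommGroup M] [Module R M] [Module.Finite R M]
    (N : Type u) [AddCommGroup N] [Module R N] [Module.Finite R N]
    (hMN : IsFiniteLength R (M ⊗[R] N)) (i : ℕ) :
    EventuallyPolynomial (fun m n =>
      torLength R i (M ⧸ (I ^ n • (⊤ : Submodule R M))) (N ⧸ (J ^ m • (⊤ : Submodule R N)))) ∧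
    ∃ k : ℕ, ∀ m n : ℕ, k ≤ m → k ≤ n →
      torLength R i (M ⧸ (I ^ n • (⊤ : Submodule R M))) (N ⧸ (J ^ m • (⊤ : Submodule R N))) =
        torLength R i M N +
        torLength R ((i : ℤ) - 1) ↥(I ^ n • (⊤ : Submodule R M)) N +
        torLength R ((i : ℤ) - 1) M ↥(J ^ m • (⊤ : Submodule R N)) +
        torLength R ((i : ℤ) - 2)
          ↥(I ^ n • (⊤ : Submodule R M)) ↥(J ^ m • (⊤ : Submodule R N)) := by
  obtain ⟨e, he⟩ := exists_maximalIdeal_pow_le_sup_annihilator hMN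
  have hfin (I J : Ideal R) (i n m : ℕ) : Module.length R (TorMod R i
      ↥(I ^ n • (⊤ : Submodule R M)) ↥(J ^ m • (⊤ : Submodule R N))) ≠ ⊤ := by
    have := isNoetherian_torMod (R := R) i ↥(I ^ n • (⊤ : Submodule R M)) ↥(J ^ m • (⊤ : Submodule R N))
    exact length_ne_top_of_maximalIdeal_pow_le (le_annihilator_torMod he
      (Submodule.subtype_injective _) (Submodule.subtype_injective _) i)
  obtain ⟨k, hk⟩ := exists_torMap_subtype_eq_zero M N
    ((Ideal.pow_right_mono (IsLocalRing.le_maximalIdeal hI) e).trans he)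
    ((Ideal.pow_right_mono (IsLocalRing.le_maximalIdeal hJ) e).trans he) i
  have formula (m n : ℕ) (hm : k ≤ m) (hn : k ≤ n) :
      torLength R i (M ⧸ (I ^ n • (⊤ : Submodule R M))) (N ⧸ (J ^ m • (⊤ : Submodule R N))) =
        torLength R i M N +
        torLength R ((i : ℤ) - 1) ↥(I ^ n • (⊤ : Submodule R M)) N +
        torLength R ((i : ℤ) - 1) M ↥(J ^ m • (⊤ : Submodule R N)) +
        torLength R ((i : ℤ) - 2)
          ↥(I ^ n • (⊤ : Submodule R M)) ↥(J ^ m • (⊤ : Submodule R N)) := by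
    have hex {X : Type u} [AddCommGroup X] [Module R X] (U : Submodule R X) :
        Function.Exact U.subtype U.mkQ := LinearMap.exact_subtype_mkQ _
    rw [torLength_eq_add_right (hex (J ^ m • (⊤ : Submodule R N)))
      (Submodule.subtype_injective _) (Submodule.mkQ_surjective _) i
      (fun j hj => (hk j hj n hn m hm).2.2),
      torLength_eq_add_left (hex (I ^ n • (⊤ : Submodule R M)))
      (Submodule.subtype_injective _) (Submodule.mkQ_surjective _) i
      (fun j hj => (hk j hj n hn m hm).1), add_assoc (_ + _)]
    congr 1
    -- What remains is `Tor_(i-1)(M/I^nM, J^mN)`, to be split once more in the first variable; for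
    -- `i = 0` everything is zero.
    cases i with
    | zero => rfl
    | succ i =>
      have h1 : ((i + 1 : ℕ) : ℤ) - 1 = i := by push_cast; ring
      have h2 : ((i + 1 : ℕ) : ℤ) - 2 = (i : ℤ) - 1 := by push_cast; ring
      rw [h1, h2]
      exact torLength_eq_add_left (hex (I ^ n • (⊤ : Submodule R M)))
        (Submodule.subtype_injective _) (Submodule.mkQ_surjective _) i
        (fun j hj => (hk j (by omega) n hn m hm).2.1)
  refine ⟨?_, k, formula⟩
  have hfinZ (I J : Ideal R) (i : ℤ) (n m : ℕ) : torLength R i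
      ↥(I ^ n • (⊤ : Submodule R M)) ↥(J ^ m • (⊤ : Submodule R N)) ≠ ⊤ := by
    cases i with
    | negSucc i => exact ENat.zero_ne_top
    | ofNat i =>
      rw [Int.ofNat_eq_natCast, torLength_natCast]
      exact hfin I J i n m
  -- Reading `M` and `N` as `⊤^n M` and `⊤^m N` puts all four summands in the form covered by the
  -- Hilbert function theorem.
  have eM (n : ℕ) : M ≃ₗ[R] ↥((⊤ : Ideal R) ^ n • (⊤ : Submodule R M)) :=
    (LinearEquiv.ofTop _ (by rw [Ideal.top_pow, Submodule.top_smul])).symm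
  have eN (n : ℕ) : N ≃ₗ[R] ↥((⊤ : Ideal R) ^ n • (⊤ : Submodule R N)) :=
    (LinearEquiv.ofTop _ (by rw [Ideal.top_pow, Submodule.top_smul])).symm
  have formula' (m n : ℕ) (hm : k ≤ m) (hn : k ≤ n) := by
    have h := formula m n hm hn
    rw [torLength_congr i (eM n) (eN m), torLength_congr ((i : ℤ) - 1) (.refl R _) (eN m),
      torLength_congr ((i : ℤ) - 1) (eM n) (.refl R _)] at h
    exact h
  obtain ⟨p, l, hp⟩ := ((((torMod_length_eventuallyPoly M N (hfin ⊤ ⊤) i).add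
    (torMod_length_eventuallyPoly M N (hfin I ⊤) ((i : ℤ) - 1))).add
    (torMod_length_eventuallyPoly M N (hfin ⊤ J) ((i : ℤ) - 1))).add
    (torMod_length_eventuallyPoly M N (hfin I J) ((i : ℤ) - 2))).swap
  refine ⟨p, max k l, fun m n hm hn => ?_⟩
  beta_reduce
  rw [← hp m n (by omega) (by omega), formula' m n (by omega) (by omega)]
  lift torLength R i ↥((⊤ : Ideal R) ^ n • (⊤ : Submodule R M))
    ↥((⊤ : Ideal R) ^ m • (⊤ : Submodule R N)) to ℕ using hfinZ _ _ _ _ _ with c₁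
  lift torLength R ((i : ℤ) - 1) ↥(I ^ n • (⊤ : Submodule R M))
    ↥((⊤ : Ideal R) ^ m • (⊤ : Submodule R N)) to ℕ using hfinZ _ _ _ _ _ with c₂
  lift torLength R ((i : ℤ) - 1) ↥((⊤ : Ideal R) ^ n • (⊤ : Submodule R M))
    ↥(J ^ m • (⊤ : Submodule R N)) to ℕ using hfinZ _ _ _ _ _ with c₃
  lift torLength R ((i : ℤ) - 2) ↥(I ^ n • (⊤ : Submodule R M))
    ↥(J ^ m • (⊤ : Submodule R N)) to ℕ using hfinZ _ _ _ _ _ with c₄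
  exact ⟨c₁ + c₂ + c₃ + c₄, by push_cast; rfl, by simp⟩
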